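/- Let $k$ be a field, $G$ a finite group with identity $e$, and $\phi:G^3\to k^\times$ a normalised 3-cocycle, i.e. for all $x,y,s,t\in G$ $$\phi(y,s,t)\,\phi(x,ys,t)\,\phi(x,y,s)=\phi(x,y,st)\,\phi(xy,s,t),\qquad \phi(x,e,y)=1 .$$ Let $k^\phi(G)$ be the algebra $k(G)$ of functions on $G$ with coproduct $(\Delta f)(x,y)=f(xy)$ and counit $f\mapsto f(e)$, regarded as a quasi-Hopf algebra with associator $\phi\in k(G)^{\otimes 3}$. Let ${}_{k^\phi(G)}\mathcal M$ be its monoidal category of modules, with associativity isomorphisms $(V\otimes W)\otimes Z\to V\otimes (W\otimes Z)$ given by the action of $\phi$. Let $({}_{k^\phi(G)}\mathcal M)^\circ$ be its double category (Drinfeld centre): the objects are pairs $(V,\lambda)$ of a module $V$ and natural isomorphisms $\lambda_W:V\otimes W\to W\otimes V$ satisfying the hexagon condition with respect to tensor products in $W$; the braiding is $\Psi_{(V,\lambda),(W,\mu)}=\lambda_W$. **Proposition 4.1.** Put $$\chi(x,y)(s)=\frac{\phi(x,y,y^{-1}x^{-1}sxy)\,\phi(s,x,y)}{\phi(x,x^{-1}sx,y)}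 .$$ Then $\chi:G\times G\to k(G)$ is a normalised 2-cocycle of $G$ with values in the invertible elements of $k(G)$, where $x\in G$ acts on $k(G)$ by $(x\cdot f)(s)=f(x^{-1}sx)$. A cocycle crossed $G$-module is a $G$-graded vector space $V$ with linear maps $v\mapsto v\triangleleft x$ ($x\in G$) such that, for all $v$ homogeneous of degree $|v|$ and all $x,y\in G$, $$(v\triangleleft x)\triangleleft y=\chi(x,y)(|v|)\; v\triangleleft(xy),\qquad v\triangleleft e=v,\qquad |v\triangleleft x|=x^{-1}|v|x .$$ The morphisms are the linear maps preserving the right action and the grading. The category of cocycle crossed $G$-modules is a monoidal category with tensor product $$|v\otimes w|=|v||w|,\qquad (v\otimes w)\triangleleft x=\frac{\phi(x,x^{-1}|v|x,x^{-1}|w|x)\,\phi(|v|,|w|,x)}{\phi(|v|,x,x^{-1}|w|x)}\;(v\triangleleft x)\otimes (w\triangleleft x)$$ for homogeneous $v,w$, with associativity isomorphism $(v\otimes w)\otimes z\mapsto \phi(|v|,|w|,|z|)\,v\otimes(w\otimes z)$. It is braided, with $$\Psi(v\otimes w)=w\otimes (v\triangleleft |w|)$$ for $w$ homogeneous. The double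 category $({}_{k^\phi(G)}\mathcal M)^\circ$ is isomorphic, as a braided monoidal category and without changing the underlying vector spaces and linear maps, to this category: $(V,\lambda)$ corresponds to $V$ with the grading and right action determined by $$f\cdot v=f(|v|)\,v\quad (f\in k(G),\ v \text{ homogeneous}),\qquad \lambda_W(v\otimes w)=w\otimes (v\triangleleft |w|)\quad (w\in W \text{ homogeneous}).$$ -/

import Mathlib

open CategoryTheory MonoidalCategory
open scoped TensorProduct

universe u v w

/-- A quasi-bialgebra over the field `k`: an algebra `H` with a coproduct that is coassociative up
to conjugation by an invertible element `Φ ∈ H ⊗ H ⊗ H`, where `Φ` is a normalised 3-cocycle. All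
triple (quadruple) tensor powers are bracketed to the right. -/
structure QuasiBialgebra (k : Type u) (H : Type v) [Field k] [Ring H] [Algebra k H] where
  /-- the coproduct `Δ` -/
  comul : H →ₐ[k] H ⊗[k] H
  /-- the counit `ε` -/
  counit : H →ₐ[k] k
  /-- the element `Φ`, often denoted by `φ` -/
  Φ : (H ⊗[k] (H ⊗[k] H))ˣ
  /-- `(id ⊗ Δ) Δ h = Φ ((Δ ⊗ id) Δ h) Φ⁻¹` -/
  quasi_coassoc : ∀ h : H,
    Algebra.TensorProduct.map (AlgHom.id k H) comul (comul h) =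
      Φ.1 * Algebra.TensorProduct.assoc k k k H H H
        (Algebra.TensorProduct.map comul (AlgHom.id k H) (comul h)) * (Φ⁻¹).1
  /-- `(ε ⊗ id) Δ = id` -/
  counit_comul : ∀ h : H, Algebra.TensorProduct.lid k H
    (Algebra.TensorProduct.map counit (AlgHom.id k H) (comul h)) = h
  /-- `(id ⊗ ε) Δ = id` -/
  comul_counit : ∀ h : H, Algebra.TensorProduct.rid k k H
    (Algebra.TensorProduct.map (AlgHom.id k H) counit (comul h)) = h
  /-- `(1 ⊗ Φ) ((id ⊗ Δ ⊗ id) Φ) (Φ ⊗ 1) = ((id ⊗ id ⊗ Δ) Φ) ((Δ ⊗ id ⊗ id) Φ)` -/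
  cocycle :
    ((1 : H) ⊗ₜ[k] Φ.1) *
      Algebra.TensorProduct.map (AlgHom.id k H)
        ((Algebra.TensorProduct.assoc k k k H H H).toAlgHom.comp
          (Algebra.TensorProduct.map comul (AlgHom.id k H))) Φ.1 *
      Algebra.TensorProduct.map (AlgHom.id k H)
        (Algebra.TensorProduct.assoc k k k H H H).toAlgHom
        (Algebra.TensorProduct.assoc k k k H (H ⊗[k] H) H (Φ.1 ⊗ₜ[k] (1 : H))) =
    Algebra.TensorProduct.map (AlgHom.id k H)
        (Algebra.TensorProduct.map (AlgHom.id k H) comul) Φ.1 *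
      Algebra.TensorProduct.assoc k k k H H (H ⊗[k] H)
        (Algebra.TensorProduct.map comul (AlgHom.id k (H ⊗[k] H)) Φ.1)
  /-- `(id ⊗ ε ⊗ id) Φ = 1 ⊗ 1` -/
  counit_Φ :
    Algebra.TensorProduct.map (AlgHom.id k H)
      ((Algebra.TensorProduct.lid k H).toAlgHom.comp
        (Algebra.TensorProduct.map counit (AlgHom.id k H))) Φ.1 = 1

namespace QuasiBialgebra

variable {k : Type u} {H : Type v} [Field k] [Ring H] [Algebra k H]

section Action

variable {V W Z U : Type u} [AddCommGroup V] [Module k V] [AddCommGroup W] [Module k W]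
  [AddCommGroup Z] [Module k Z] [AddCommGroup U] [Module k U]

/-- The action of `H ⊗ H` on `V ⊗ W`, for `H` acting on `V` and on `W`. -/
noncomputable def act₂ {K : Type*} [Ring K] [Algebra k K] (ρV : H →ₐ[k] Module.End k V)
    (ρW : K →ₐ[k] Module.End k W) :
    H ⊗[k] K →ₐ[k] Module.End k (V ⊗[k] W) :=
  Module.endTensorEndAlgHom.comp (Algebra.TensorProduct.map ρV ρW)

@[simp]
theorem act₂_tmul {K : Type*} [Ring K] [Algebra k K] (ρV : H →ₐ[k] Module.End k V)
    (ρW : K →ₐ[k] Module.End k W) (a : H) (b : K) (x : V) (y : W) :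
    act₂ ρV ρW (a ⊗ₜ b) (x ⊗ₜ y) = ρV a x ⊗ₜ ρW b y := rfl

/-- The action of `H ⊗ H ⊗ H` on `V ⊗ (W ⊗ Z)`. -/
noncomputable abbrev act₃ (ρV : H →ₐ[k] Module.End k V) (ρW : H →ₐ[k] Module.End k W)
    (ρZ : H →ₐ[k] Module.End k Z) :
    H ⊗[k] (H ⊗[k] H) →ₐ[k] Module.End k (V ⊗[k] (W ⊗[k] Z)) :=
  act₂ ρV (act₂ ρW ρZ)

/-- The action of `H ⊗ H ⊗ H ⊗ H` on `V ⊗ (W ⊗ (Z ⊗ U))`. -/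
noncomputable abbrev act₄ (ρV : H →ₐ[k] Module.End k V) (ρW : H →ₐ[k] Module.End k W)
    (ρZ : H →ₐ[k] Module.End k Z) (ρU : H →ₐ[k] Module.End k U) :
    H ⊗[k] (H ⊗[k] (H ⊗[k] H)) →ₐ[k] Module.End k (V ⊗[k] (W ⊗[k] (Z ⊗[k] U))) :=
  act₂ ρV (act₃ ρW ρZ ρU)

variable (A : QuasiBialgebra k H)

/-- The action of `H` on `V ⊗ W` through the coproduct. -/
noncomputable def tensorAct (ρV : H →ₐ[k] Module.End k V) (ρW : H →ₐ[k] Module.End k W) :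
    H →ₐ[k] Module.End k (V ⊗[k] W) :=
  (act₂ ρV ρW).comp A.comul

/-- The action of `H` on `k` through the counit. -/
noncomputable def unitAct : H →ₐ[k] Module.End k k :=
  (Algebra.lmul k k).comp A.counit

theorem tensorAct_apply (ρV : H →ₐ[k] Module.End k V) (ρW : H →ₐ[k] Module.End k W) (h : H) :
    A.tensorAct ρV ρW h = act₂ ρV ρW (A.comul h) := rfl

theorem unitAct_apply (h : H) (c : k) : A.unitAct h c = A.counit h * c := rfl

theorem act₂_natural {K : Type*} [Ring K] [Algebra k K] {V' W' : Type u} [AddCommGroup V']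
    [Module k V'] [AddCommGroup W'] [Module k W'] {ρV : H →ₐ[k] Module.End k V}
    {ρW : K →ₐ[k] Module.End k W} {ρV' : H →ₐ[k] Module.End k V'} {ρW' : K →ₐ[k] Module.End k W'}
    (f : V →ₗ[k] V') (g : W →ₗ[k] W') (hf : ∀ h v, f (ρV h v) = ρV' h (f v))
    (hg : ∀ h v, g (ρW h v) = ρW' h (g v)) (t : H ⊗[k] K) (v : V ⊗[k] W) :
    TensorProduct.map f g (act₂ ρV ρW t v) = act₂ ρV' ρW' t (TensorProduct.map f g v) := by
  induction t with
  | zero => simp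
  | add a b ha hb => simp only [map_add, LinearMap.add_apply, ha, hb]
  | tmul a b =>
    induction v with
    | zero => simp
    | add a b ha hb => simp only [map_add, ha, hb]
    | tmul x y => simp [hf, hg]

variable (ρV : H →ₐ[k] Module.End k V) (ρW : H →ₐ[k] Module.End k W)
  (ρZ : H →ₐ[k] Module.End k Z) (ρU : H →ₐ[k] Module.End k U)

theorem act₃_right (t : H ⊗[k] H) :
    act₂ ρV (A.tensorAct ρW ρZ) t =
      act₃ ρV ρW ρZ (Algebra.TensorProduct.map (AlgHom.id k H) A.comul t) := by
  induction t with
  | zero => simp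
  | add a b ha hb => simp only [map_add, ha, hb]
  | tmul a b => apply TensorProduct.ext'; intro x y; simp [tensorAct_apply]

theorem act₃_left {K : Type*} [Ring K] [Algebra k K] (ρK : K →ₐ[k] Module.End k Z)
    (t : H ⊗[k] K) (v : (V ⊗[k] W) ⊗[k] Z) :
    TensorProduct.assoc k V W Z (act₂ (A.tensorAct ρV ρW) ρK t v) =
      act₂ ρV (act₂ ρW ρK) (Algebra.TensorProduct.assoc k k k H H K
        (Algebra.TensorProduct.map A.comul (AlgHom.id k K) t))
        (TensorProduct.assoc k V W Z v) := by
  induction t with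
  | zero => simp
  | add a b ha hb => simp only [map_add, LinearMap.add_apply, ha, hb]
  | tmul a b =>
    induction v with
    | zero => simp
    | add a b ha hb => simp only [map_add, ha, hb]
    | tmul x z =>
      simp only [act₂_tmul, tensorAct_apply, Algebra.TensorProduct.map_tmul, AlgHom.id_apply]
      generalize A.comul a = d
      induction d with
      | zero => simp
      | add a b ha hb => simp only [map_add, LinearMap.add_apply, ha, hb, TensorProduct.add_tmul]
      | tmul c d =>
        induction x with
        | zero => simp
        | add a b ha hb => simp only [map_add, ha, hb, TensorProduct.add_tmul]
        | tmul x y => simp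

theorem act₄_right (t : H ⊗[k] (H ⊗[k] H)) :
    act₃ ρV ρW (A.tensorAct ρZ ρU) t = act₄ ρV ρW ρZ ρU (Algebra.TensorProduct.map (AlgHom.id k H)
      (Algebra.TensorProduct.map (AlgHom.id k H) A.comul) t) := by
  induction t with
  | zero => simp
  | add a b ha hb => simp only [map_add, ha, hb]
  | tmul a b =>
    apply TensorProduct.ext'; intro x y
    simp [act₃_right]

theorem act₄_mid (t : H ⊗[k] (H ⊗[k] H)) (v : V ⊗[k] ((W ⊗[k] Z) ⊗[k] U)) :
    TensorProduct.map (LinearMap.id : V →ₗ[k] V)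
        (TensorProduct.assoc k W Z U).toLinearMap (act₃ ρV (A.tensorAct ρW ρZ) ρU t v) =
      act₄ ρV ρW ρZ ρU (Algebra.TensorProduct.map (AlgHom.id k H)
        ((Algebra.TensorProduct.assoc k k k H H H).toAlgHom.comp
          (Algebra.TensorProduct.map A.comul (AlgHom.id k H))) t)
        (TensorProduct.map (LinearMap.id : V →ₗ[k] V)
          (TensorProduct.assoc k W Z U).toLinearMap v) := by
  induction t with
  | zero => simp
  | add a b ha hb => simp only [map_add, LinearMap.add_apply, ha, hb]
  | tmul a b =>
    induction v with
    | zero => simp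
    | add a b ha hb => simp only [map_add, ha, hb]
    | tmul x z => simp [act₃_left]

theorem act₄_outer (t : H ⊗[k] (H ⊗[k] H)) (v : (V ⊗[k] (W ⊗[k] Z)) ⊗[k] U) :
    TensorProduct.map (LinearMap.id : V →ₗ[k] V)
        (TensorProduct.assoc k W Z U).toLinearMap
        (TensorProduct.assoc k V (W ⊗[k] Z) U
          (TensorProduct.map (act₃ ρV ρW ρZ t) (LinearMap.id : U →ₗ[k] U) v)) =
      act₄ ρV ρW ρZ ρU (Algebra.TensorProduct.map (AlgHom.id k H)
        (Algebra.TensorProduct.assoc k k k H H H).toAlgHom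
        (Algebra.TensorProduct.assoc k k k H (H ⊗[k] H) H (t ⊗ₜ[k] (1 : H))))
        (TensorProduct.map (LinearMap.id : V →ₗ[k] V)
          (TensorProduct.assoc k W Z U).toLinearMap
          (TensorProduct.assoc k V (W ⊗[k] Z) U v)) := by
  induction t with
  | zero => simp
  | add a b ha hb =>
    simp only [map_add, LinearMap.add_apply, TensorProduct.map_add_left, ha, hb,
      TensorProduct.add_tmul]
  | tmul a b =>
    induction b with
    | zero => simp
    | add a b ha hb =>
      simp only [map_add, LinearMap.add_apply, TensorProduct.map_add_left, ha, hb,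
        TensorProduct.add_tmul, TensorProduct.tmul_add]
    | tmul b c =>
      induction v with
      | zero => simp
      | add a b ha hb => simp only [map_add, ha, hb]
      | tmul x u =>
        induction x with
        | zero => simp
        | add a b ha hb => simp only [map_add, ha, hb, TensorProduct.add_tmul]
        | tmul x y =>
          induction y with
          | zero => simp
          | add a b ha hb =>
            simp only [map_add, ha, hb, TensorProduct.add_tmul, TensorProduct.tmul_add]
          | tmul y z => simp

theorem act₃_unit (t : H ⊗[k] (H ⊗[k] H)) (v : V ⊗[k] (k ⊗[k] W)) :
    TensorProduct.map (LinearMap.id : V →ₗ[k] V) (TensorProduct.lid k W).toLinearMap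
        (act₃ ρV A.unitAct ρW t v) =
      act₂ ρV ρW (Algebra.TensorProduct.map (AlgHom.id k H)
        ((Algebra.TensorProduct.lid k H).toAlgHom.comp
          (Algebra.TensorProduct.map A.counit (AlgHom.id k H))) t)
        (TensorProduct.map (LinearMap.id : V →ₗ[k] V)
          (TensorProduct.lid k W).toLinearMap v) := by
  induction t with
  | zero => simp
  | add a b ha hb => simp only [map_add, LinearMap.add_apply, ha, hb]
  | tmul a b =>
    induction b with
    | zero => simp
    | add a b ha hb =>
      simp only [map_add, LinearMap.add_apply, ha, hb, TensorProduct.tmul_add]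
    | tmul b c =>
      induction v with
      | zero => simp
      | add a b ha hb => simp only [map_add, ha, hb]
      | tmul x y =>
        induction y with
        | zero => simp
        | add a b ha hb => simp only [map_add, ha, hb, TensorProduct.tmul_add]
        | tmul r y =>
          simp [mul_smul, unitAct_apply]
          exact smul_comm _ _ _

theorem lid_act (h : H) (v : k ⊗[k] V) :
    TensorProduct.lid k V (A.tensorAct A.unitAct ρV h v) = ρV h (TensorProduct.lid k V v) := by
  rw [tensorAct_apply]
  conv_rhs => rw [← A.counit_comul h]
  generalize A.comul h = d
  induction d with
  | zero => simp
  | add a b ha hb => simp only [map_add, LinearMap.add_apply, ha, hb]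
  | tmul a b =>
    induction v with
    | zero => simp
    | add a b ha hb => simp only [map_add, ha, hb]
    | tmul c x =>
      simp [mul_smul, unitAct_apply]
      exact smul_comm _ _ _

theorem rid_act (h : H) (v : V ⊗[k] k) :
    TensorProduct.rid k V (A.tensorAct ρV A.unitAct h v) = ρV h (TensorProduct.rid k V v) := by
  rw [tensorAct_apply]
  conv_rhs => rw [← A.comul_counit h]
  generalize A.comul h = d
  induction d with
  | zero => simp
  | add a b ha hb => simp only [map_add, LinearMap.add_apply, ha, hb]
  | tmul a b =>
    induction v with
    | zero => simp
    | add a b ha hb => simp only [map_add, ha, hb]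
    | tmul x c =>
      simp [mul_smul, unitAct_apply]
      exact smul_comm _ _ _

/-- The associator `(V ⊗ W) ⊗ Z ≃ V ⊗ (W ⊗ Z)`: rebracketing, followed by the action of `Φ`. -/
noncomputable def assocEquiv : (V ⊗[k] W) ⊗[k] Z ≃ₗ[k] V ⊗[k] (W ⊗[k] Z) :=
  (TensorProduct.assoc k V W Z).trans
    (LinearMap.GeneralLinearGroup.generalLinearEquiv k _
      (Units.map (act₃ ρV ρW ρZ : _ →* _) A.Φ))

theorem assocEquiv_apply (v : (V ⊗[k] W) ⊗[k] Z) :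
    A.assocEquiv ρV ρW ρZ v = act₃ ρV ρW ρZ A.Φ.1 (TensorProduct.assoc k V W Z v) := rfl

theorem assocEquiv_act (h : H) (v : (V ⊗[k] W) ⊗[k] Z) :
    A.assocEquiv ρV ρW ρZ (A.tensorAct (A.tensorAct ρV ρW) ρZ h v) =
      A.tensorAct ρV (A.tensorAct ρW ρZ) h (A.assocEquiv ρV ρW ρZ v) := by
  rw [assocEquiv_apply, assocEquiv_apply, tensorAct_apply, tensorAct_apply, act₃_left, act₃_right,
    A.quasi_coassoc, ← Module.End.mul_apply, ← Module.End.mul_apply, ← map_mul, ← map_mul,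
    mul_assoc _ _ A.Φ.1, Units.inv_mul, mul_one]

theorem assoc_pentagon (v : ((V ⊗[k] W) ⊗[k] Z) ⊗[k] U) :
    TensorProduct.map (LinearMap.id : V →ₗ[k] V)
        (TensorProduct.assoc k W Z U).toLinearMap
        (TensorProduct.assoc k V (W ⊗[k] Z) U
          (TensorProduct.map (TensorProduct.assoc k V W Z).toLinearMap
            (LinearMap.id : U →ₗ[k] U) v)) =
      TensorProduct.assoc k V W (Z ⊗[k] U) (TensorProduct.assoc k (V ⊗[k] W) Z U v) := by
  have : (TensorProduct.map (LinearMap.id : V →ₗ[k] V)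
        (TensorProduct.assoc k W Z U).toLinearMap ∘ₗ
        (TensorProduct.assoc k V (W ⊗[k] Z) U).toLinearMap ∘ₗ
          (TensorProduct.map (TensorProduct.assoc k V W Z).toLinearMap
            (LinearMap.id : U →ₗ[k] U))) =
      (TensorProduct.assoc k V W (Z ⊗[k] U)).toLinearMap ∘ₗ
        (TensorProduct.assoc k (V ⊗[k] W) Z U).toLinearMap := by
    ext; simp
  exact LinearMap.congr_fun this v

theorem assocEquiv_pentagon (v : ((V ⊗[k] W) ⊗[k] Z) ⊗[k] U) :
    TensorProduct.map (LinearMap.id : V →ₗ[k] V) (A.assocEquiv ρW ρZ ρU).toLinearMap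
      (A.assocEquiv ρV (A.tensorAct ρW ρZ) ρU
        (TensorProduct.map (A.assocEquiv ρV ρW ρZ).toLinearMap (LinearMap.id : U →ₗ[k] U) v)) =
      A.assocEquiv ρV ρW (A.tensorAct ρZ ρU) (A.assocEquiv (A.tensorAct ρV ρW) ρZ ρU v) := by
  have e1 : ∀ w : ((V ⊗[k] W) ⊗[k] Z) ⊗[k] U,
      TensorProduct.map (A.assocEquiv ρV ρW ρZ).toLinearMap (LinearMap.id : U →ₗ[k] U) w =
        TensorProduct.map (act₃ ρV ρW ρZ A.Φ.1) (LinearMap.id : U →ₗ[k] U)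
          (TensorProduct.map (TensorProduct.assoc k V W Z).toLinearMap
            (LinearMap.id : U →ₗ[k] U) w) := by
    intro w
    rw [← LinearMap.comp_apply, ← TensorProduct.map_comp]
    rfl
  have e2 : ∀ w : V ⊗[k] ((W ⊗[k] Z) ⊗[k] U),
      TensorProduct.map (LinearMap.id : V →ₗ[k] V) (A.assocEquiv ρW ρZ ρU).toLinearMap w =
        act₄ ρV ρW ρZ ρU ((1 : H) ⊗ₜ A.Φ.1)
          (TensorProduct.map (LinearMap.id : V →ₗ[k] V)
            (TensorProduct.assoc k W Z U).toLinearMap w) := by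
    intro w
    have : act₄ ρV ρW ρZ ρU ((1 : H) ⊗ₜ A.Φ.1) =
        TensorProduct.map LinearMap.id (act₃ ρW ρZ ρU A.Φ.1) := by
      apply TensorProduct.ext'; intro x y; simp
    rw [this, ← LinearMap.comp_apply, ← TensorProduct.map_comp]
    rfl
  rw [e2, assocEquiv_apply, assocEquiv_apply, assocEquiv_apply, act₄_mid, e1, act₄_outer ρV ρW ρZ ρU,
    act₄_right, act₃_left, assoc_pentagon]
  have c := congrArg (act₄ ρV ρW ρZ ρU) A.cocycle
  rw [map_mul, map_mul, map_mul] at c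
  exact LinearMap.congr_fun c _

theorem assocEquiv_triangle (v : (V ⊗[k] k) ⊗[k] W) :
    TensorProduct.map (LinearMap.id : V →ₗ[k] V) (TensorProduct.lid k W).toLinearMap
      (A.assocEquiv ρV A.unitAct ρW v) =
    TensorProduct.map (TensorProduct.rid k V).toLinearMap (LinearMap.id : W →ₗ[k] W) v := by
  rw [assocEquiv_apply, act₃_unit, A.counit_Φ, map_one, Module.End.one_apply]
  have : (TensorProduct.map (LinearMap.id : V →ₗ[k] V) (TensorProduct.lid k W).toLinearMap ∘ₗ
    (TensorProduct.assoc k V k W).toLinearMap) =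
    TensorProduct.map (TensorProduct.rid k V).toLinearMap (LinearMap.id : W →ₗ[k] W) := by
    ext; simp
  exact LinearMap.congr_fun this v

end Action

/-- A left module over (the algebra underlying) a quasi-bialgebra: a vector space `V` together
with an algebra homomorphism `ρ : H → End V`. -/
structure Rep (A : QuasiBialgebra k H) where
  /-- the underlying vector space -/
  V : Type u
  [addCommGroup : AddCommGroup V]
  [module : Module k V]
  /-- the action of `H` -/
  ρ : H →ₐ[k] Module.End k V

namespace Rep

attribute [instance] Rep.addCommGroup Rep.module

variable {A : QuasiBialgebra k H}

/-- Morphisms of modules: `H`-linear maps. -/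
@[ext]
structure Hom (X Y : Rep A) where
  /-- the underlying linear map -/
  lin : X.V →ₗ[k] Y.V
  comm : ∀ (h : H) (v : X.V), lin (X.ρ h v) = Y.ρ h (lin v)

instance : Category (Rep A) where
  Hom X Y := Hom X Y
  id X := ⟨LinearMap.id, fun _ _ => rfl⟩
  comp f g := ⟨g.lin ∘ₗ f.lin, fun h v => by simp [f.comm, g.comm]⟩

@[ext]
theorem hom_ext {X Y : Rep A} (f g : X ⟶ Y) (h : f.lin = g.lin) : f = g := Hom.ext h

@[simp]
theorem id_lin (X : Rep A) : Hom.lin (𝟙 X) = LinearMap.id := rfl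

@[simp]
theorem comp_lin {X Y Z : Rep A} (f : X ⟶ Y) (g : Y ⟶ Z) : (f ≫ g).lin = g.lin ∘ₗ f.lin := rfl

/-- A bijective linear map commuting with the action is an isomorphism of modules. -/
def mkIso {X Y : Rep A} (e : X.V ≃ₗ[k] Y.V) (he : ∀ h v, e (X.ρ h v) = Y.ρ h (e v)) : X ≅ Y where
  hom := ⟨e.toLinearMap, he⟩
  inv := ⟨e.symm.toLinearMap, fun h v => by
    apply e.injective
    simp [he]⟩
  hom_inv_id := by ext v; simp
  inv_hom_id := by ext v; simp

/-- The tensor product of modules: `H` acts on `V ⊗ W` through the coproduct. -/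
noncomputable def tensor (X Y : Rep A) : Rep A where
  V := X.V ⊗[k] Y.V
  ρ := A.tensorAct X.ρ Y.ρ

/-- The unit object: `k` with `H` acting through the counit. -/
noncomputable def unit (A : QuasiBialgebra k H) : Rep A where
  V := k
  ρ := A.unitAct

/-- The tensor product of morphisms. -/
noncomputable def tensorMap {X X' Y Y' : Rep A} (f : X ⟶ X') (g : Y ⟶ Y') :
    tensor X Y ⟶ tensor X' Y' :=
  ⟨TensorProduct.map f.lin g.lin, fun _ v => act₂_natural f.lin g.lin f.comm g.comm _ v⟩

/-- The associator, left unitor and right unitor are `A.assocEquiv` and the usual ones of vector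
spaces. -/
noncomputable instance : MonoidalCategoryStruct (Rep A) where
  tensorObj := tensor
  tensorHom f g := tensorMap f g
  whiskerLeft X _ _ f := tensorMap (𝟙 X) f
  whiskerRight f Y := tensorMap f (𝟙 Y)
  tensorUnit := unit A
  associator X Y Z := mkIso (X := tensor (tensor X Y) Z) (Y := tensor X (tensor Y Z))
    (A.assocEquiv X.ρ Y.ρ Z.ρ) (A.assocEquiv_act X.ρ Y.ρ Z.ρ)
  leftUnitor X := mkIso (X := tensor (unit A) X) (TensorProduct.lid k X.V) (A.lid_act X.ρ)
  rightUnitor X := mkIso (X := tensor X (unit A)) (TensorProduct.rid k X.V) (A.rid_act X.ρ)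

/-- The monoidal category of modules over a quasi-bialgebra. -/
noncomputable instance : MonoidalCategory (Rep A) :=
  MonoidalCategory.ofTensorHom
    (id_tensorHom_id := fun _ _ => hom_ext _ _ TensorProduct.map_id)
    (id_tensorHom := fun _ _ _ _ => rfl)
    (tensorHom_id := fun _ _ => rfl)
    (tensorHom_comp_tensorHom := fun f₁ f₂ g₁ g₂ =>
      hom_ext _ _ (TensorProduct.map_comp g₁.lin g₂.lin f₁.lin f₂.lin).symm)
    (associator_naturality := by
      intro X₁ X₂ X₃ Y₁ Y₂ Y₃ f g h
      refine hom_ext _ _ (LinearMap.ext fun v => ?_)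
      refine ((act₂_natural f.lin (TensorProduct.map g.lin h.lin) f.comm
        (act₂_natural g.lin h.lin g.comm h.comm) A.Φ.1
        (TensorProduct.assoc k X₁.V X₂.V X₃.V v)).trans ?_).symm
      exact congrArg (act₃ Y₁.ρ Y₂.ρ Y₃.ρ A.Φ.1)
        (TensorProduct.map_map_assoc f.lin g.lin h.lin v))
    (leftUnitor_naturality := fun f => hom_ext _ _
      (TensorProduct.ext' fun c x => (f.lin.map_smul c x).symm))
    (rightUnitor_naturality := fun f => hom_ext _ _
      (TensorProduct.ext' fun x c => (f.lin.map_smul c x).symm))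
    (pentagon := fun X Y Z U => hom_ext _ _
      (LinearMap.ext fun v => A.assocEquiv_pentagon X.ρ Y.ρ Z.ρ U.ρ v))
    (triangle := fun X Y => hom_ext _ _
      (LinearMap.ext fun v => A.assocEquiv_triangle X.ρ Y.ρ v))

end Rep

end QuasiBialgebra

/-- A normalised group 3-cocycle of `G` with values in the invertible scalars. -/
structure ThreeCocycle (k : Type u) (G : Type w) [Field k] [Group G] where
  /-- the underlying function `φ` -/
  toFun : G → G → G → kˣ
  cocycle : ∀ x y s t : G,
    toFun y s t * toFun x (y * s) t * toFun x y s = toFun x y (s * t) * toFun (x * y) s t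
  normalised : ∀ x y : G, toFun x 1 y = 1

namespace ThreeCocycle

variable {k : Type u} {G : Type w} [Field k] [Group G]

instance : CoeFun (ThreeCocycle k G) (fun _ => G → G → G → kˣ) := ⟨ThreeCocycle.toFun⟩

end ThreeCocycle

namespace FunctionAlgebra

variable {k : Type u} {G : Type w} [Field k]

variable (k) in
/-- Evaluation of the first tensor factor at `x`. -/
noncomputable def ev (K : Type*) [Ring K] [Algebra k K] (x : G) : (G → k) ⊗[k] K →ₐ[k] K :=
  (Algebra.TensorProduct.lid k K).toAlgHom.comp
    (Algebra.TensorProduct.map (Pi.evalAlgHom k (fun _ : G => k) x) (AlgHom.id k K))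

@[simp]
theorem ev_tmul {K : Type*} [Ring K] [Algebra k K] (x : G) (f : G → k) (a : K) :
    ev k K x (f ⊗ₜ[k] a) = f x • a := by
  simp [ev]

theorem ev_map_id {K L : Type*} [Ring K] [Algebra k K] [Ring L] [Algebra k L] (x : G)
    (g : K →ₐ[k] L) (t : (G → k) ⊗[k] K) :
    ev k L x (Algebra.TensorProduct.map (AlgHom.id k (G → k)) g t) = g (ev k K x t) := by
  induction t with
  | zero => simp
  | add a b ha hb => simp only [map_add, ha, hb]
  | tmul f a => simp

theorem ev_assoc_tmul {K L : Type*} [Ring K] [Algebra k K] [Ring L] [Algebra k L] (x : G)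
    (t : (G → k) ⊗[k] K) (c : L) :
    ev k (K ⊗[k] L) x (Algebra.TensorProduct.assoc k k k (G → k) K L (t ⊗ₜ[k] c)) =
      ev k K x t ⊗ₜ[k] c := by
  induction t with
  | zero => simp
  | add a b ha hb => simp only [map_add, ha, hb, TensorProduct.add_tmul]
  | tmul f a => simp [TensorProduct.smul_tmul']

variable [Fintype G] [DecidableEq G]

theorem ev_ext {K : Type*} [Ring K] [Algebra k K] {t t' : (G → k) ⊗[k] K}
    (h : ∀ x : G, ev k K x t = ev k K x t') : t = t' := by
  have key : ∀ t : (G → k) ⊗[k] K, t = ∑ x : G, (Pi.single x (1 : k) : G → k) ⊗ₜ[k] ev k K x t := by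
    intro t
    induction t with
    | zero => simp
    | add a b ha hb =>
      conv_lhs => rw [ha, hb]
      simp [TensorProduct.tmul_add, Finset.sum_add_distrib]
    | tmul f a =>
      have hf : f = ∑ x : G, f x • (Pi.single x (1 : k) : G → k) := by
        ext y
        simp [Pi.single_apply]
      conv_lhs => rw [hf, TensorProduct.sum_tmul]
      simp [TensorProduct.smul_tmul]
  rw [key t, key t']
  simp [h]

variable (k G) in
/-- The coproduct of the algebra of functions on `G`: `(Δ f)(x, y) = f (x y)`, that is,
`Δ f = ∑ f (x y) δ_x ⊗ δ_y`. -/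
noncomputable def comul [Group G] : (G → k) →ₐ[k] (G → k) ⊗[k] (G → k) :=
  AlgHom.ofLinearMap
    (∑ x : G, ∑ y : G, (LinearMap.proj (x * y) : (G → k) →ₗ[k] k).smulRight
      ((Pi.single x (1 : k) : G → k) ⊗ₜ[k] (Pi.single y (1 : k) : G → k)))
    (by
      apply ev_ext; intro x; ext y
      simp [Pi.single_apply, ite_apply, Algebra.TensorProduct.one_def])
    (by
      intro f g
      apply ev_ext; intro x; ext y
      simp [Pi.single_apply, ite_apply])

theorem comul_apply [Group G] (f : G → k) : comul k G f = ∑ x : G, ∑ y : G,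
    f (x * y) • ((Pi.single x (1 : k) : G → k) ⊗ₜ[k] (Pi.single y (1 : k) : G → k)) := by
  simp [comul]

theorem ev_comul [Group G] (f : G → k) (x y : G) : ev k (G → k) x (comul k G f) y = f (x * y) := by
  simp [comul_apply, Pi.single_apply, ite_apply]

theorem ev_assoc_comul [Group G] {K : Type*} [Ring K] [Algebra k K] (x y : G)
    (t : (G → k) ⊗[k] K) :
    ev k K y (ev k ((G → k) ⊗[k] K) x (Algebra.TensorProduct.assoc k k k (G → k) (G → k) K
      (Algebra.TensorProduct.map (comul k G) (AlgHom.id k K) t))) = ev k K (x * y) t := by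
  induction t with
  | zero => simp
  | add a b ha hb => simp only [map_add, ha, hb]
  | tmul f a => simp [ev_assoc_tmul, ev_comul]

/-- The element `∑ φ (x, y, z) δ_x ⊗ δ_y ⊗ δ_z` given by a function of three variables. -/
noncomputable def tensor₃ (φ : G → G → G → k) : (G → k) ⊗[k] ((G → k) ⊗[k] (G → k)) :=
  ∑ x : G, ∑ y : G, ∑ z : G, φ x y z • ((Pi.single x (1 : k) : G → k) ⊗ₜ[k]
    ((Pi.single y (1 : k) : G → k) ⊗ₜ[k] (Pi.single z (1 : k) : G → k)))

theorem ev_tensor₃ (φ : G → G → G → k) (x y z : G) :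
    ev k (G → k) y (ev k ((G → k) ⊗[k] (G → k)) x (tensor₃ φ)) z = φ x y z := by
  simp [tensor₃, Pi.single_apply, ite_apply]

theorem tensor₃_mul (φ ψ : G → G → G → k) (h : ∀ x y z, φ x y z * ψ x y z = 1) :
    tensor₃ φ * tensor₃ ψ = 1 := by
  apply ev_ext; intro x; apply ev_ext; intro y; ext z
  simp [tensor₃, Pi.single_apply, Algebra.TensorProduct.one_def, h]

end FunctionAlgebra

/-- The algebra of functions on `G` as a quasi-bialgebra, with `Φ` given by the 3-cocycle `φ`. -/
noncomputable def ThreeCocycle.quasiBialgebra {k : Type u} {G : Type w} [Field k] [Group G]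
    [Fintype G] [DecidableEq G] (φ : ThreeCocycle k G) : QuasiBialgebra k (G → k) where
  comul := FunctionAlgebra.comul k G
  counit := Pi.evalAlgHom k (fun _ : G => k) 1
  Φ :=
    { val := FunctionAlgebra.tensor₃ fun x y z => (φ x y z : k)
      inv := FunctionAlgebra.tensor₃ fun x y z => ((φ x y z)⁻¹ : kˣ)
      val_inv := FunctionAlgebra.tensor₃_mul _ _ fun x y z => by simp
      inv_val := FunctionAlgebra.tensor₃_mul _ _ fun x y z => by simp }
  quasi_coassoc f := by
    apply FunctionAlgebra.ev_ext; intro x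
    apply FunctionAlgebra.ev_ext; intro y
    ext z
    simp only [map_mul, Pi.mul_apply, FunctionAlgebra.ev_map_id, FunctionAlgebra.ev_assoc_comul,
      FunctionAlgebra.ev_comul, Units.inv_mk, FunctionAlgebra.ev_tensor₃, mul_assoc]
    rw [mul_left_comm]
    simp
  counit_comul f := by
    ext x
    exact (FunctionAlgebra.ev_comul f 1 x).trans (by rw [one_mul])
  comul_counit f := by
    ext x
    simp [FunctionAlgebra.comul_apply, Pi.single_apply]
  cocycle := by
    apply FunctionAlgebra.ev_ext; intro x
    apply FunctionAlgebra.ev_ext; intro y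
    apply FunctionAlgebra.ev_ext; intro z
    ext t
    have h := congrArg (Units.val : kˣ → k) (φ.cocycle x y z t)
    simp only [Units.val_mul] at h
    simp only [map_mul, Pi.mul_apply, FunctionAlgebra.ev_map_id, FunctionAlgebra.ev_assoc_comul,
      FunctionAlgebra.ev_comul, FunctionAlgebra.ev_tensor₃, FunctionAlgebra.ev_tmul,
      FunctionAlgebra.ev_assoc_tmul, Pi.one_apply, one_smul, AlgHom.comp_apply]
    simpa [FunctionAlgebra.ev_tensor₃, FunctionAlgebra.ev_assoc_comul,
      FunctionAlgebra.ev_assoc_tmul] using h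
  counit_Φ := by
    apply FunctionAlgebra.ev_ext; intro x
    ext y
    rw [FunctionAlgebra.ev_map_id]
    refine (FunctionAlgebra.ev_tensor₃ (fun x y z => (φ x y z : k)) x 1 y).trans ?_
    simp [φ.normalised, Algebra.TensorProduct.one_def]

namespace ThreeCocycle
variable {k : Type u} {G : Type w} [Field k] [Group G]

theorem additive (φ : ThreeCocycle k G) (x y s t : G) :
    Additive.ofMul (φ y s t) + Additive.ofMul (φ x (y * s) t) + Additive.ofMul (φ x y s) =
      Additive.ofMul (φ x y (s * t)) + Additive.ofMul (φ (x * y) s t) :=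
  congrArg Additive.ofMul (φ.cocycle x y s t)

/-- The function `χ (x, y) (s) = φ (x, y, y⁻¹ x⁻¹ s x y) φ (s, x, y) / φ (x, x⁻¹ s x, y)`. -/
def χ (φ : ThreeCocycle k G) (x y s : G) : kˣ :=
  φ x y (y⁻¹ * x⁻¹ * s * x * y) * φ s x y / φ x (x⁻¹ * s * x) y

/-- The factor `φ (x, x⁻¹ s x, x⁻¹ t x) φ (s, t, x) / φ (s, x, x⁻¹ t x)` in the action of `x` on a
tensor product of elements of degrees `s` and `t`. -/
def τ (φ : ThreeCocycle k G) (s t x : G) : kˣ :=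
  φ x (x⁻¹ * s * x) (x⁻¹ * t * x) * φ s t x / φ s x (x⁻¹ * t * x)

theorem τ_mul (φ : ThreeCocycle k G) (s t x y : G) :
    φ.τ s t x * φ.τ (x⁻¹ * s * x) (x⁻¹ * t * x) y * φ.χ x y s * φ.χ x y t =
      φ.χ x y (s * t) * φ.τ s t (x * y) := by
  obtain ⟨a, rfl⟩ : ∃ a, s = x * (y * a * y⁻¹) * x⁻¹ := ⟨y⁻¹ * (x⁻¹ * s * x) * y, by group⟩
  obtain ⟨b, rfl⟩ : ∃ b, t = x * (y * b * y⁻¹) * x⁻¹ := ⟨y⁻¹ * (x⁻¹ * t * x) * y, by group⟩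
  have h1 := φ.additive (x * (y * a * y⁻¹) * x⁻¹) (x * (y * b * y⁻¹) * x⁻¹) x y
  have h2 := φ.additive (x * (y * a * y⁻¹) * x⁻¹) x (y * b * y⁻¹) y
  have h3 := φ.additive x (y * a * y⁻¹) (y * b * y⁻¹) y
  have h4 := φ.additive (x * (y * a * y⁻¹) * x⁻¹) x y b
  have h5 := φ.additive x (y * a * y⁻¹) y b
  have h6 := φ.additive x y a b
  apply Additive.ofMul.injective
  simp only [χ, τ, ofMul_mul, ofMul_div]
  simp only [mul_assoc, inv_mul_cancel_left, inv_mul_cancel, mul_one, mul_inv_rev] at *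
  linear_combination (norm := abel) h1 - h2 + h3 + h4 - h5 + h6

theorem τ_assoc (φ : ThreeCocycle k G) (s t r x : G) :
    φ.τ s t x * φ.τ (s * t) r x * φ (x⁻¹ * s * x) (x⁻¹ * t * x) (x⁻¹ * r * x) =
      φ s t r * φ.τ t r x * φ.τ s (t * r) x := by
  obtain ⟨a, rfl⟩ : ∃ a, s = x * a * x⁻¹ := ⟨(x⁻¹ * s * x), by group⟩
  obtain ⟨b, rfl⟩ : ∃ b, t = x * b * x⁻¹ := ⟨(x⁻¹ * t * x), by group⟩
  obtain ⟨c, rfl⟩ : ∃ c, r = x * c * x⁻¹ := ⟨(x⁻¹ * r * x), by group⟩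
  have h1 := φ.additive (x * a * x⁻¹) (x * b * x⁻¹) (x * c * x⁻¹) x
  have h2 := φ.additive (x * a * x⁻¹) (x * b * x⁻¹) x c
  have h3 := φ.additive (x * a * x⁻¹) x b c
  have h4 := φ.additive x a b c
  apply Additive.ofMul.injective
  simp only [τ, ofMul_mul, ofMul_div]
  simp only [mul_assoc, inv_mul_cancel_left, inv_mul_cancel, mul_one] at *
  linear_combination (norm := abel) -h1 + h2 - h3 + h4

theorem one_left (φ : ThreeCocycle k G) (x y : G) : φ 1 x y = 1 := by
  have h := φ.cocycle 1 1 x y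
  simpa [φ.normalised] using h

theorem one_right (φ : ThreeCocycle k G) (x y : G) : φ x y 1 = 1 := by
  have h := φ.cocycle x y 1 1
  simpa [φ.normalised] using h

end ThreeCocycle

section TensorGrading

variable {k : Type u} {G : Type w} [Field k] [Mul G] {V W : Type*}
  [AddCommGroup V] [Module k V] [AddCommGroup W] [Module k W]

/-- The grading of a tensor product: the component of degree `r` is spanned by the `v ⊗ w` with `v`
and `w` homogeneous and `|v| |w| = r`. -/
def tensorGrading (A : G → Submodule k V) (B : G → Submodule k W) (r : G) :
    Submodule k (V ⊗[k] W) :=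
  Submodule.span k {u | ∃ s t v w, v ∈ A s ∧ w ∈ B t ∧ s * t = r ∧ v ⊗ₜ[k] w = u}

theorem tmul_mem_tensorGrading {A : G → Submodule k V} {B : G → Submodule k W} {s t : G} {v : V} {w : W} (hv : v ∈ A s)
    (hw : w ∈ B t) : v ⊗ₜ[k] w ∈ tensorGrading A B (s * t) :=
  Submodule.subset_span ⟨s, t, v, w, hv, hw, rfl, rfl⟩

end TensorGrading

namespace DirectSum.IsInternal

variable {k : Type u} {G : Type w} [Field k] [DecidableEq G] {V W U : Type*}
  [AddCommGroup V] [Module k V] [AddCommGroup W] [Module k W] [AddCommGroup U] [Module k U]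
  {A : G → Submodule k V} {B : G → Submodule k W}

/-- The isomorphism from the direct sum of the components. -/
noncomputable def equiv (h : DirectSum.IsInternal A) : (DirectSum G fun s => A s) ≃ₗ[k] V :=
  LinearEquiv.ofBijective (DirectSum.coeLinearMap A) h

theorem equiv_lof (h : DirectSum.IsInternal A) (s : G) (v : A s) :
    h.equiv (DirectSum.lof k G (fun s => A s) s v) = v :=
  DirectSum.coeLinearMap_lof A s v

/-- The projection onto the component of degree `s`. -/
noncomputable def proj (h : DirectSum.IsInternal A) (s : G) : V →ₗ[k] V :=
  (A s).subtype ∘ₗ DirectSum.component k G (fun s => A s) s ∘ₗ h.equiv.symm.toLinearMap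

theorem proj_mem (h : DirectSum.IsInternal A) (s : G) (v : V) : h.proj s v ∈ A s :=
  Subtype.property _

theorem proj_of_mem (h : DirectSum.IsInternal A) (s : G) {t : G} {v : V} (hv : v ∈ A t) :
    h.proj s v = if t = s then v else 0 := by
  have h1 : h.equiv.symm v = DirectSum.lof k G (fun s => A s) t ⟨v, hv⟩ := by
    rw [LinearEquiv.symm_apply_eq, equiv_lof]
  simp only [proj, LinearMap.comp_apply, LinearEquiv.coe_coe, h1]
  split_ifs with hst
  · subst hst
    simp [DirectSum.component.lof_self]
  · simp [DirectSum.component.of, hst]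

variable [Fintype G]

theorem sum_proj (h : DirectSum.IsInternal A) (v : V) : ∑ s, h.proj s v = v := by
  obtain ⟨d, rfl⟩ := h.2 v
  induction d using DirectSum.induction_on with
  | zero => simp
  | of t a => simp [DirectSum.coeAddMonoidHom_of, h.proj_of_mem _ a.2]
  | add a b ha hb => simp only [map_add, Finset.sum_add_distrib, ha, hb]

theorem of_proj (p : G → V →ₗ[k] V) (h1 : ∀ s v, p s v ∈ A s)
    (h2 : ∀ s t, ∀ v ∈ A t, p s v = if t = s then v else 0) (h3 : ∀ v, ∑ s, p s v = v) :
    DirectSum.IsInternal A := by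
  have h4 : ∀ (d : DirectSum G fun s => A s) (s : G),
      p s (DirectSum.coeAddMonoidHom A d) = d s := by
    intro d s
    induction d using DirectSum.induction_on with
    | zero => simp
    | of t a =>
      rw [DirectSum.coeAddMonoidHom_of, h2 s t _ a.2, DirectSum.coe_of_apply]
      split_ifs <;> rfl
    | add a b ha hb => simp [ha, hb]
  refine ⟨(injective_iff_map_eq_zero _).2 fun d hd => ?_, fun v =>
    ⟨∑ s, DirectSum.of (fun s => A s) s ⟨p s v, h1 s v⟩, by simp [h3]⟩⟩
  refine DFinsupp.ext fun s => Subtype.ext ?_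
  rw [← h4, hd]
  simp

theorem linearMap_ext (h : DirectSum.IsInternal A) {f g : V →ₗ[k] U}
    (hfg : ∀ s, ∀ v ∈ A s, f v = g v) : f = g := by
  ext v
  rw [← h.sum_proj v, map_sum, map_sum]
  exact Finset.sum_congr rfl fun s _ => hfg s _ (h.proj_mem s v)

theorem tensor_ext (hA : DirectSum.IsInternal A) (hB : DirectSum.IsInternal B)
    {f g : V ⊗[k] W →ₗ[k] U}
    (hfg : ∀ s t, ∀ v ∈ A s, ∀ w ∈ B t, f (v ⊗ₜ w) = g (v ⊗ₜ w)) : f = g := by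
  refine TensorProduct.ext (hA.linearMap_ext fun s v hv => hB.linearMap_ext fun t w hw => ?_)
  exact hfg s t v hv w hw

theorem tensor [Mul G] (hA : DirectSum.IsInternal A) (hB : DirectSum.IsInternal B) :
    DirectSum.IsInternal (tensorGrading A B) := by
  refine of_proj (fun r => ∑ s, ∑ t, if s * t = r then TensorProduct.map (hA.proj s) (hB.proj t)
    else 0) ?_ ?_ ?_
  · intro r v
    induction v with
    | zero => simp
    | add a b ha hb => rw [map_add]; exact add_mem ha hb
    | tmul v w =>
      simp only [LinearMap.sum_apply]
      refine Submodule.sum_mem _ fun s _ => Submodule.sum_mem _ fun t _ => ?_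
      split_ifs with h
      · subst h
        exact tmul_mem_tensorGrading (hA.proj_mem _ _) (hB.proj_mem _ _)
      · simp
  · intro r r' u hu
    induction hu using Submodule.span_induction with
    | zero => simp
    | add a b _ _ ha hb =>
      rw [map_add, ha, hb]
      split_ifs <;> simp
    | smul c a _ ha =>
      rw [map_smul, ha]
      split_ifs <;> simp
    | mem u hu =>
      obtain ⟨s, t, v, w, hv, hw, rfl, rfl⟩ := hu
      simp only [LinearMap.sum_apply]
      rw [Finset.sum_eq_single s, Finset.sum_eq_single t]
      · split_ifs <;> simp [hA.proj_of_mem _ hv, hB.proj_of_mem _ hw]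
      · intro t' _ ht
        split_ifs <;> simp [hB.proj_of_mem _ hw, ht.symm]
      · simp
      · intro s' _ hs
        refine Finset.sum_eq_zero fun t' _ => ?_
        split_ifs <;> simp [hA.proj_of_mem _ hv, hs.symm]
      · simp
  · intro v
    induction v with
    | zero => simp
    | add a b ha hb => simp only [map_add, Finset.sum_add_distrib, ha, hb]
    | tmul v w =>
      simp only [LinearMap.sum_apply]
      rw [Finset.sum_comm]
      have : ∀ s : G, (∑ r : G, ∑ t : G, (if s * t = r then
          TensorProduct.map (hA.proj s) (hB.proj t) else 0) (v ⊗ₜ[k] w)) = hA.proj s v ⊗ₜ w := by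
        intro s
        rw [Finset.sum_comm]
        have : ∀ t : G, (∑ r : G, (if s * t = r then
          TensorProduct.map (hA.proj s) (hB.proj t) else 0) (v ⊗ₜ[k] w)) =
            hA.proj s v ⊗ₜ hB.proj t w := by
          intro t
          rw [Finset.sum_eq_single (s * t)]
          · simp
          · intro r _ hr
            simp [hr.symm]
          · simp
        simp only [this]
        rw [← TensorProduct.tmul_sum, hB.sum_proj]
      simp only [this]
      rw [← TensorProduct.sum_tmul, hA.sum_proj]

end DirectSum.IsInternal

section CrossedStructure

variable {k : Type u} {G : Type w} [Field k] [Group G] [DecidableEq G]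

/-- The structure of a cocycle crossed `G`-module on a vector space `V`: a `G`-grading and a right
cocycle action of `G` (the linear map `act x` is `v ↦ v ◁ x`) compatible with the grading. -/
structure CrossedStructure (φ : ThreeCocycle k G) (V : Type*) [AddCommGroup V] [Module k V] where
  /-- `grading s` is the space of homogeneous elements of degree `s` -/
  grading : G → Submodule k V
  /-- `V` is the direct sum of its homogeneous components -/
  isInternal : DirectSum.IsInternal grading
  /-- the right action `v ◁ x` -/
  act : G → V →ₗ[k] V
  /-- `(v ◁ x) ◁ y = χ (x, y) (|v|) v ◁ (x y)` -/
  act_act : ∀ (x y s : G), ∀ v ∈ grading s, act y (act x v) = (φ.χ x y s : k) • act (x * y) v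
  /-- `v ◁ 1 = v` -/
  act_one : ∀ v : V, act 1 v = v
  /-- `|v ◁ x| = x⁻¹ |v| x` -/
  act_mem : ∀ (x s : G), ∀ v ∈ grading s, act x v ∈ grading (x⁻¹ * s * x)

/-- A linear map preserving the grading and the right action. -/
structure IsCrossedHom {φ : ThreeCocycle k G} {V W : Type*} [AddCommGroup V] [Module k V]
    [AddCommGroup W] [Module k W] (S : CrossedStructure φ V) (T : CrossedStructure φ W)
    (f : V →ₗ[k] W) : Prop where
  map_mem : ∀ s : G, ∀ v ∈ S.grading s, f v ∈ T.grading s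
  map_act : ∀ (x : G) (v : V), f (S.act x v) = T.act x (f v)

namespace CrossedStructure

variable {φ : ThreeCocycle k G} {V W Z U : Type*} [AddCommGroup V] [Module k V] [AddCommGroup W]
  [Module k W] [AddCommGroup Z] [Module k Z] [AddCommGroup U] [Module k U]
  (S : CrossedStructure φ V) (T : CrossedStructure φ W) (R : CrossedStructure φ Z)
  (Q : CrossedStructure φ U)

variable (φ) in
/-- The unit object: `k` in degree `1` with trivial action. -/
noncomputable def unit : CrossedStructure φ k where
  grading s := if s = 1 then ⊤ else ⊥
  isInternal := by
    have h : iSupIndep (fun s : G => (if s = 1 then ⊤ else ⊥ : Submodule k k)) := by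
      intro s
      by_cases hs : s = 1
      · have : (⨆ (j : G) (_ : j ≠ s), (if j = 1 then ⊤ else ⊥ : Submodule k k)) = ⊥ := by
          simp only [iSup_eq_bot]
          intro j hj
          rw [if_neg (fun h => hj (h.trans hs.symm))]
        rw [this]
        exact disjoint_bot_right
      · simp [hs]
    refine (DirectSum.isInternal_submodule_iff_iSupIndep_and_iSup_eq_top _).2 ⟨h, ?_⟩
    exact top_le_iff.1 (le_trans (by simp) (le_iSup (fun s : G =>
      (if s = 1 then ⊤ else ⊥ : Submodule k k)) 1))
  act _ := LinearMap.id
  act_act x y s v hv := by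
    by_cases hs : s = 1
    · subst hs
      simp [ThreeCocycle.χ, φ.normalised, φ.one_left, φ.one_right, mul_assoc]
    · rw [if_neg hs, Submodule.mem_bot] at hv
      simp [hv]
  act_one _ := rfl
  act_mem x s v hv := by
    by_cases hs : s = 1
    · subst hs
      simp
    · rw [if_neg hs, Submodule.mem_bot] at hv
      simp [hv]

theorem mem_unit {s : G} {c : k} (hc : c ∈ (unit φ).grading s) : s = 1 ∨ c = 0 := by
  by_cases hs : s = 1
  · exact Or.inl hs
  · exact Or.inr (by simpa [unit, hs] using hc)

variable [Fintype G]

/-- The right action on a tensor product, extended bilinearly from the formula for homogeneous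
elements in `tensorAct_tmul`. -/
noncomputable def tensorAct (x : G) : V ⊗[k] W →ₗ[k] V ⊗[k] W :=
  ∑ s : G, ∑ t : G, (φ.τ s t x : k) • TensorProduct.map (S.act x ∘ₗ S.isInternal.proj s)
    (T.act x ∘ₗ T.isInternal.proj t)

theorem tensorAct_tmul (x : G) {s t : G} {v : V} {w : W} (hv : v ∈ S.grading s)
    (hw : w ∈ T.grading t) :
    S.tensorAct T x (v ⊗ₜ w) = (φ.τ s t x : k) • (S.act x v ⊗ₜ T.act x w) := by
  simp only [tensorAct, LinearMap.sum_apply]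
  rw [Finset.sum_eq_single s, Finset.sum_eq_single t]
  · simp [S.isInternal.proj_of_mem _ hv, T.isInternal.proj_of_mem _ hw]
  · intro t' _ ht
    simp [T.isInternal.proj_of_mem _ hw, ht.symm]
  · simp
  · intro s' _ hs
    refine Finset.sum_eq_zero fun t' _ => ?_
    simp [S.isInternal.proj_of_mem _ hv, hs.symm]
  · simp

/-- The tensor product of cocycle crossed modules: `|v ⊗ w| = |v| |w|` and
`(v ⊗ w) ◁ x = τ (|v|, |w|, x) (v ◁ x) ⊗ (w ◁ x)` for homogeneous `v` and `w`. -/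
noncomputable def tensor : CrossedStructure φ (V ⊗[k] W) where
  grading := tensorGrading S.grading T.grading
  isInternal := S.isInternal.tensor T.isInternal
  act := S.tensorAct T
  act_act x y r u hu := by
    induction hu using Submodule.span_induction with
    | zero => simp
    | add a b _ _ ha hb => simp only [map_add, smul_add, ha, hb]
    | smul c a _ ha => simp only [map_smul, ha, smul_comm c]
    | mem u hu =>
      obtain ⟨s, t, v, w, hv, hw, rfl, rfl⟩ := hu
      rw [tensorAct_tmul S T x hv hw, tensorAct_tmul S T (x * y) hv hw, map_smul,
        tensorAct_tmul S T y (S.act_mem x s v hv) (T.act_mem x t w hw), S.act_act x y s v hv,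
        T.act_act x y t w hw, TensorProduct.smul_tmul_smul, smul_smul, smul_smul, smul_smul]
      have h := congrArg (Units.val : kˣ → k) (φ.τ_mul s t x y)
      simp only [Units.val_mul] at h
      rw [← h]
      congr 1
      ring
  act_one u := by
    refine LinearMap.congr_fun (f := S.tensorAct T 1) (g := LinearMap.id) ?_ u
    refine S.isInternal.tensor_ext T.isInternal fun s t v hv w hw => ?_
    rw [tensorAct_tmul S T 1 hv hw]
    simp [S.act_one, T.act_one, ThreeCocycle.τ, φ.one_left, φ.one_right, φ.normalised]
  act_mem x r u hu := by
    induction hu using Submodule.span_induction with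
    | zero => simp
    | add a b _ _ ha hb => rw [map_add]; exact add_mem ha hb
    | smul c a _ ha => rw [map_smul]; exact Submodule.smul_mem _ c ha
    | mem u hu =>
      obtain ⟨s, t, v, w, hv, hw, rfl, rfl⟩ := hu
      rw [tensorAct_tmul S T x hv hw]
      refine Submodule.smul_mem _ _ ?_
      have h : x⁻¹ * (s * t) * x = (x⁻¹ * s * x) * (x⁻¹ * t * x) := by group
      rw [h]
      exact tmul_mem_tensorGrading (S.act_mem x s v hv) (T.act_mem x t w hw)

theorem tensor_act_tmul (x : G) {s t : G} {v : V} {w : W} (hv : v ∈ S.grading s)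
    (hw : w ∈ T.grading t) :
    (S.tensor T).act x (v ⊗ₜ w) = (φ.τ s t x : k) • (S.act x v ⊗ₜ T.act x w) :=
  S.tensorAct_tmul T x hv hw

theorem tmul_mem {s t : G} {v : V} {w : W} (hv : v ∈ S.grading s) (hw : w ∈ T.grading t) :
    v ⊗ₜ w ∈ (S.tensor T).grading (s * t) :=
  tmul_mem_tensorGrading hv hw

/-- To check that a linear map out of a tensor product is a morphism, it is enough to consider
tensor products of homogeneous elements. -/
theorem isCrossedHom_tensor {f : V ⊗[k] W →ₗ[k] Z}
    (h1 : ∀ s t, ∀ v ∈ S.grading s, ∀ w ∈ T.grading t, f (v ⊗ₜ w) ∈ R.grading (s * t))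
    (h2 : ∀ x s t, ∀ v ∈ S.grading s, ∀ w ∈ T.grading t,
      (φ.τ s t x : k) • f (S.act x v ⊗ₜ T.act x w) = R.act x (f (v ⊗ₜ w))) :
    IsCrossedHom (S.tensor T) R f where
  map_mem r u hu := by
    induction hu using Submodule.span_induction with
    | zero => simp
    | add a b _ _ ha hb => rw [map_add]; exact add_mem ha hb
    | smul c a _ ha => rw [map_smul]; exact Submodule.smul_mem _ c ha
    | mem u hu =>
      obtain ⟨s, t, v, w, hv, hw, rfl, rfl⟩ := hu
      exact h1 s t v hv w hw
  map_act x u := by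
    refine LinearMap.congr_fun (f := f ∘ₗ (S.tensor T).act x) (g := R.act x ∘ₗ f) ?_ u
    refine S.isInternal.tensor_ext T.isInternal fun s t v hv w hw => ?_
    rw [LinearMap.comp_apply, LinearMap.comp_apply, tensor_act_tmul S T x hv hw, map_smul]
    exact h2 x s t v hv w hw

theorem tensor₃_ext {f g : (V ⊗[k] W) ⊗[k] Z →ₗ[k] U}
    (hfg : ∀ s t r, ∀ v ∈ S.grading s, ∀ w ∈ T.grading t, ∀ z ∈ R.grading r,
      f ((v ⊗ₜ w) ⊗ₜ z) = g ((v ⊗ₜ w) ⊗ₜ z)) : f = g := by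
  refine TensorProduct.ext (S.isInternal.tensor_ext T.isInternal fun s t v hv w hw => ?_)
  exact R.isInternal.linearMap_ext fun r z hz => hfg s t r v hv w hw z hz

theorem tensor₃_ext' {f g : V ⊗[k] (W ⊗[k] Z) →ₗ[k] U}
    (hfg : ∀ s t r, ∀ v ∈ S.grading s, ∀ w ∈ T.grading t, ∀ z ∈ R.grading r,
      f (v ⊗ₜ (w ⊗ₜ z)) = g (v ⊗ₜ (w ⊗ₜ z))) : f = g := by
  refine TensorProduct.ext (S.isInternal.linearMap_ext fun s v hv => ?_)
  exact T.isInternal.tensor_ext R.isInternal fun t r w hw z hz => hfg s t r v hv w hw z hz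

/-- Multiplication of `v ⊗ (w ⊗ z)` by `c (|v|, |w|, |z|)` for homogeneous `v`, `w`, `z`. -/
noncomputable def scale (c : G → G → G → k) : V ⊗[k] (W ⊗[k] Z) →ₗ[k] V ⊗[k] (W ⊗[k] Z) :=
  ∑ s : G, ∑ t : G, ∑ r : G, c s t r • TensorProduct.map (S.isInternal.proj s)
    (TensorProduct.map (T.isInternal.proj t) (R.isInternal.proj r))

theorem scale_tmul (c : G → G → G → k) {s t r : G} {v : V} {w : W} {z : Z}
    (hv : v ∈ S.grading s) (hw : w ∈ T.grading t) (hz : z ∈ R.grading r) :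
    S.scale T R c (v ⊗ₜ (w ⊗ₜ z)) = c s t r • (v ⊗ₜ (w ⊗ₜ z)) := by
  simp only [scale, LinearMap.sum_apply]
  rw [Finset.sum_eq_single s, Finset.sum_eq_single t, Finset.sum_eq_single r]
  · simp [S.isInternal.proj_of_mem _ hv, T.isInternal.proj_of_mem _ hw,
      R.isInternal.proj_of_mem _ hz]
  · intro r' _ hr
    simp [R.isInternal.proj_of_mem _ hz, hr.symm]
  · simp
  · intro t' _ ht
    refine Finset.sum_eq_zero fun r' _ => ?_
    simp [T.isInternal.proj_of_mem _ hw, ht.symm]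
  · simp
  · intro s' _ hs
    refine Finset.sum_eq_zero fun t' _ => Finset.sum_eq_zero fun r' _ => ?_
    simp [S.isInternal.proj_of_mem _ hv, hs.symm]
  · simp

theorem scale_comp_scale (c d : G → G → G → k) (h : ∀ s t r, c s t r * d s t r = 1) :
    S.scale T R c ∘ₗ S.scale T R d = LinearMap.id :=
  tensor₃_ext' S T R fun s t r v hv w hw z hz => by
    rw [LinearMap.comp_apply, scale_tmul S T R _ hv hw hz, map_smul,
      scale_tmul S T R _ hv hw hz, smul_smul, mul_comm, h, one_smul, LinearMap.id_apply]

/-- The map `S.scale T R φ` as a linear equivalence. -/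
noncomputable def scaleEquiv : V ⊗[k] (W ⊗[k] Z) ≃ₗ[k] V ⊗[k] (W ⊗[k] Z) :=
  LinearEquiv.ofLinearMap (S.scale T R fun s t r => (φ s t r : k))
    (S.scale T R fun s t r => (((φ s t r)⁻¹ : kˣ) : k))
    (scale_comp_scale S T R _ _ fun s t r => (φ s t r).mul_inv)
    (scale_comp_scale S T R _ _ fun s t r => (φ s t r).inv_mul)

/-- The associator `(v ⊗ w) ⊗ z ↦ φ (|v|, |w|, |z|) v ⊗ (w ⊗ z)`. -/
noncomputable def assoc : (V ⊗[k] W) ⊗[k] Z ≃ₗ[k] V ⊗[k] (W ⊗[k] Z) :=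
  (TensorProduct.assoc k V W Z).trans (S.scaleEquiv T R)

theorem assoc_tmul {s t r : G} {v : V} {w : W} {z : Z}
    (hv : v ∈ S.grading s) (hw : w ∈ T.grading t) (hz : z ∈ R.grading r) :
    S.assoc T R ((v ⊗ₜ w) ⊗ₜ z) = (φ s t r : k) • (v ⊗ₜ (w ⊗ₜ z)) :=
  S.scale_tmul T R _ hv hw hz

theorem isCrossedHom_assoc :
    IsCrossedHom ((S.tensor T).tensor R) (S.tensor (T.tensor R))
      (S.assoc T R).toLinearMap where
  map_mem q u hu := by
    induction hu using Submodule.span_induction with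
    | zero => simp
    | add a b _ _ ha hb => rw [map_add]; exact add_mem ha hb
    | smul c a _ ha => rw [map_smul]; exact Submodule.smul_mem _ c ha
    | mem u hu =>
      obtain ⟨p, r, a, z, ha, hz, rfl, rfl⟩ := hu
      induction ha using Submodule.span_induction with
      | zero => simp
      | add a b _ _ ha hb => rw [TensorProduct.add_tmul, map_add]; exact add_mem ha hb
      | smul c a _ ha =>
        rw [← TensorProduct.smul_tmul', map_smul]; exact Submodule.smul_mem _ c ha
      | mem a ha =>
        obtain ⟨s, t, v, w, hv, hw, rfl, rfl⟩ := ha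
        rw [LinearEquiv.coe_coe, assoc_tmul S T R hv hw hz, mul_assoc]
        exact Submodule.smul_mem _ _ (tmul_mem S _ hv (tmul_mem T R hw hz))
  map_act x u := by
    refine LinearMap.congr_fun (f := (S.assoc T R).toLinearMap ∘ₗ ((S.tensor T).tensor R).act x)
      (g := (S.tensor (T.tensor R)).act x ∘ₗ (S.assoc T R).toLinearMap) ?_ u
    refine tensor₃_ext S T R fun s t r v hv w hw z hz => ?_
    simp only [LinearMap.comp_apply, LinearEquiv.coe_coe]
    rw [tensor_act_tmul _ R x (tmul_mem S T hv hw) hz, tensor_act_tmul S T x hv hw,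
      assoc_tmul S T R hv hw hz, map_smul, map_smul,
      tensor_act_tmul S _ x hv (tmul_mem T R hw hz), tensor_act_tmul T R x hw hz,
      ← TensorProduct.smul_tmul', map_smul,
      assoc_tmul S T R (S.act_mem x s v hv) (T.act_mem x t w hw) (R.act_mem x r z hz),
      TensorProduct.tmul_smul, smul_smul, smul_smul, smul_smul, smul_smul]
    have h := congrArg (Units.val : kˣ → k) (φ.τ_assoc s t r x)
    simp only [Units.val_mul] at h
    congr 1
    linear_combination h

theorem isCrossedHom_lid :
    IsCrossedHom ((unit φ).tensor S) S (TensorProduct.lid k V).toLinearMap := by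
  refine isCrossedHom_tensor _ S S (fun s t c hc v hv => ?_) fun x s t c hc v hv => ?_
  · rcases mem_unit hc with rfl | rfl
    · simpa using Submodule.smul_mem _ c hv
    · simp
  · rcases mem_unit hc with rfl | rfl
    · simp [unit, ThreeCocycle.τ, φ.one_left, φ.normalised]
    · simp [unit]

theorem isCrossedHom_rid :
    IsCrossedHom (S.tensor (unit φ)) S (TensorProduct.rid k V).toLinearMap := by
  refine isCrossedHom_tensor S _ S (fun s t v hv c hc => ?_) fun x s t v hv c hc => ?_
  · rcases mem_unit hc with rfl | rfl
    · simpa using Submodule.smul_mem _ c hv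
    · simp
  · rcases mem_unit hc with rfl | rfl
    · simp [unit, ThreeCocycle.τ, φ.one_right, φ.normalised]
    · simp [unit]

theorem isCrossedHom_map {V' W' : Type*} [AddCommGroup V'] [Module k V'] [AddCommGroup W']
    [Module k W'] {S' : CrossedStructure φ V'} {T' : CrossedStructure φ W'} {f : V →ₗ[k] V'}
    {g : W →ₗ[k] W'} (hf : IsCrossedHom S S' f) (hg : IsCrossedHom T T' g) :
    IsCrossedHom (S.tensor T) (S'.tensor T') (TensorProduct.map f g) := by
  refine isCrossedHom_tensor S T _ (fun s t v hv w hw => ?_) fun x s t v hv w hw => ?_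
  · exact tmul_mem S' T' (hf.map_mem s v hv) (hg.map_mem t w hw)
  · rw [TensorProduct.map_tmul, TensorProduct.map_tmul,
      tensor_act_tmul S' T' x (hf.map_mem s v hv) (hg.map_mem t w hw), hf.map_act, hg.map_act]

theorem assoc_natural {V' W' Z' : Type*} [AddCommGroup V'] [Module k V'] [AddCommGroup W']
    [Module k W'] [AddCommGroup Z'] [Module k Z'] {S' : CrossedStructure φ V'}
    {T' : CrossedStructure φ W'} {R' : CrossedStructure φ Z'} {f : V →ₗ[k] V'}
    {g : W →ₗ[k] W'} {h : Z →ₗ[k] Z'} (hf : IsCrossedHom S S' f) (hg : IsCrossedHom T T' g)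
    (hh : IsCrossedHom R R' h) :
    (S'.assoc T' R').toLinearMap ∘ₗ TensorProduct.map (TensorProduct.map f g) h =
      TensorProduct.map f (TensorProduct.map g h) ∘ₗ (S.assoc T R).toLinearMap := by
  refine tensor₃_ext S T R fun s t r v hv w hw z hz => ?_
  simp only [LinearMap.comp_apply, LinearEquiv.coe_coe, TensorProduct.map_tmul]
  rw [assoc_tmul S T R hv hw hz, assoc_tmul S' T' R' (hf.map_mem s v hv) (hg.map_mem t w hw)
    (hh.map_mem r z hz), map_smul]
  simp

theorem assoc_pentagon :
    TensorProduct.map LinearMap.id (T.assoc R Q).toLinearMap ∘ₗ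
      (S.assoc (T.tensor R) Q).toLinearMap ∘ₗ
        TensorProduct.map (S.assoc T R).toLinearMap LinearMap.id =
      (S.assoc T (R.tensor Q)).toLinearMap ∘ₗ ((S.tensor T).assoc R Q).toLinearMap := by
  refine TensorProduct.ext (tensor₃_ext S T R fun s t r v hv w hw z hz => ?_)
  refine Q.isInternal.linearMap_ext fun q u hu => ?_
  change TensorProduct.map LinearMap.id (T.assoc R Q).toLinearMap
      (S.assoc (T.tensor R) Q (S.assoc T R ((v ⊗ₜ w) ⊗ₜ z) ⊗ₜ u)) =
    S.assoc T (R.tensor Q) ((S.tensor T).assoc R Q (((v ⊗ₜ w) ⊗ₜ z) ⊗ₜ u))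
  rw [assoc_tmul S T R hv hw hz, assoc_tmul _ R Q (tmul_mem S T hv hw) hz hu, map_smul,
    assoc_tmul S T _ hv hw (tmul_mem R Q hz hu), ← TensorProduct.smul_tmul', map_smul,
    assoc_tmul S _ Q hv (tmul_mem T R hw hz) hu, map_smul, map_smul, TensorProduct.map_tmul,
    LinearEquiv.coe_coe, assoc_tmul T R Q hw hz hu, LinearMap.id_apply, TensorProduct.tmul_smul,
    smul_smul, smul_smul, smul_smul]
  have h := congrArg (Units.val : kˣ → k) (φ.cocycle s t r q)
  simp only [Units.val_mul] at h
  congr 1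
  linear_combination h

theorem assoc_triangle :
    TensorProduct.map LinearMap.id (TensorProduct.lid k W).toLinearMap ∘ₗ
      (S.assoc (unit φ) T).toLinearMap =
      TensorProduct.map (TensorProduct.rid k V).toLinearMap LinearMap.id := by
  refine tensor₃_ext S (unit φ) T fun s t r v hv c hc w hw => ?_
  rw [LinearMap.comp_apply, LinearEquiv.coe_coe, assoc_tmul S (unit φ) T hv hc hw]
  rcases mem_unit hc with rfl | rfl
  · simp [φ.normalised, TensorProduct.smul_tmul']
  · simp

end CrossedStructure

end CrossedStructure

/-- The category of cocycle crossed `G`-modules. -/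
structure Crossed {k : Type u} {G : Type w} [Field k] [Group G] [DecidableEq G]
    (φ : ThreeCocycle k G) where
  /-- the underlying vector space -/
  V : Type u
  [addCommGroup : AddCommGroup V]
  [module : Module k V]
  /-- the grading and the action -/
  str : CrossedStructure φ V

namespace Crossed

attribute [instance] Crossed.addCommGroup Crossed.module

variable {k : Type u} {G : Type w} [Field k] [Group G] [DecidableEq G] {φ : ThreeCocycle k G}

/-- Morphisms: linear maps preserving the right action and the grading. -/
@[ext]
structure Hom (X Y : Crossed φ) where
  /-- the underlying linear map -/
  lin : X.V →ₗ[k] Y.V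
  isCrossedHom : IsCrossedHom X.str Y.str lin

instance : Category (Crossed φ) where
  Hom X Y := Hom X Y
  id X := ⟨LinearMap.id, ⟨fun _ _ h => h, fun _ _ => rfl⟩⟩
  comp f g := ⟨g.lin ∘ₗ f.lin,
    ⟨fun s v h => g.isCrossedHom.map_mem s _ (f.isCrossedHom.map_mem s v h), fun x v => by
      simp [f.isCrossedHom.map_act, g.isCrossedHom.map_act]⟩⟩

@[ext]
theorem hom_ext {X Y : Crossed φ} (f g : X ⟶ Y) (h : f.lin = g.lin) : f = g := Hom.ext h

@[simp]
theorem id_lin (X : Crossed φ) : Hom.lin (𝟙 X) = LinearMap.id := rfl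

@[simp]
theorem comp_lin {X Y Z : Crossed φ} (f : X ⟶ Y) (g : Y ⟶ Z) : (f ≫ g).lin = g.lin ∘ₗ f.lin :=
  rfl

variable [Fintype G]

theorem isCrossedHom_symm {X Y : Crossed φ} (e : X.V ≃ₗ[k] Y.V)
    (he : IsCrossedHom X.str Y.str e.toLinearMap) :
    IsCrossedHom Y.str X.str e.symm.toLinearMap where
  map_mem s v hv := by
    have h : ∀ t, e (X.str.isInternal.proj t (e.symm v)) = if s = t then v else 0 := by
      have h1 : ∑ t, e (X.str.isInternal.proj t (e.symm v)) = v := by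
        rw [← map_sum, X.str.isInternal.sum_proj, e.apply_symm_apply]
      intro t
      rw [← Y.str.isInternal.proj_of_mem t hv]
      conv_rhs => rw [← h1, map_sum]
      rw [Finset.sum_eq_single t]
      · exact ((Y.str.isInternal.proj_of_mem t
          (he.map_mem t _ (X.str.isInternal.proj_mem t _))).trans (if_pos rfl)).symm
      · intro t' _ ht
        exact (Y.str.isInternal.proj_of_mem t
          (he.map_mem t' _ (X.str.isInternal.proj_mem t' _))).trans (if_neg ht)
      · simp
    have h2 : e.symm v = X.str.isInternal.proj s (e.symm v) := by
      rw [LinearEquiv.symm_apply_eq, h s, if_pos rfl]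
    rw [LinearEquiv.coe_coe, h2]
    exact X.str.isInternal.proj_mem s _
  map_act x v := by
    apply e.injective
    have := he.map_act x (e.symm v)
    simp only [LinearEquiv.coe_coe, LinearEquiv.apply_symm_apply] at this ⊢
    exact this.symm

/-- A bijective morphism is an isomorphism. -/
def mkIso {X Y : Crossed φ} (e : X.V ≃ₗ[k] Y.V) (he : IsCrossedHom X.str Y.str e.toLinearMap) :
    X ≅ Y where
  hom := ⟨e.toLinearMap, he⟩
  inv := ⟨e.symm.toLinearMap, isCrossedHom_symm e he⟩
  hom_inv_id := by ext v; simp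
  inv_hom_id := by ext v; simp

/-- The tensor product of cocycle crossed modules, on the tensor product of vector spaces. -/
noncomputable def tensor (X Y : Crossed φ) : Crossed φ where
  V := X.V ⊗[k] Y.V
  str := X.str.tensor Y.str

variable (φ) in
/-- The unit object. -/
noncomputable def unit : Crossed φ where
  V := k
  str := CrossedStructure.unit φ

/-- The tensor product of morphisms. -/
noncomputable def tensorMap {X X' Y Y' : Crossed φ} (f : X ⟶ X') (g : Y ⟶ Y') :
    tensor X Y ⟶ tensor X' Y' :=
  ⟨TensorProduct.map f.lin g.lin,
    CrossedStructure.isCrossedHom_map X.str Y.str f.isCrossedHom g.isCrossedHom⟩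

noncomputable instance : MonoidalCategoryStruct (Crossed φ) where
  tensorObj := tensor
  tensorHom f g := tensorMap f g
  whiskerLeft X _ _ f := tensorMap (𝟙 X) f
  whiskerRight f Y := tensorMap f (𝟙 Y)
  tensorUnit := unit φ
  associator X Y Z := mkIso (X := tensor (tensor X Y) Z) (Y := tensor X (tensor Y Z))
    (X.str.assoc Y.str Z.str) (X.str.isCrossedHom_assoc Y.str Z.str)
  leftUnitor X := mkIso (X := tensor (unit φ) X) (TensorProduct.lid k X.V) X.str.isCrossedHom_lid
  rightUnitor X := mkIso (X := tensor X (unit φ)) (TensorProduct.rid k X.V) X.str.isCrossedHom_rid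

/-- The monoidal category of cocycle crossed modules. -/
noncomputable instance : MonoidalCategory (Crossed φ) :=
  MonoidalCategory.ofTensorHom
    (id_tensorHom_id := fun _ _ => hom_ext _ _ TensorProduct.map_id)
    (id_tensorHom := fun _ _ _ _ => rfl)
    (tensorHom_id := fun _ _ => rfl)
    (tensorHom_comp_tensorHom := fun f₁ f₂ g₁ g₂ =>
      hom_ext _ _ (TensorProduct.map_comp g₁.lin g₂.lin f₁.lin f₂.lin).symm)
    (associator_naturality := fun {X₁ X₂ X₃ _ _ _} f g h => hom_ext _ _
      (CrossedStructure.assoc_natural X₁.str X₂.str X₃.str f.isCrossedHom g.isCrossedHom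
        h.isCrossedHom))
    (leftUnitor_naturality := fun f => hom_ext _ _
      (TensorProduct.ext' fun c x => (f.lin.map_smul c x).symm))
    (rightUnitor_naturality := fun f => hom_ext _ _
      (TensorProduct.ext' fun x c => (f.lin.map_smul c x).symm))
    (pentagon := fun X Y Z U => hom_ext _ _
      (CrossedStructure.assoc_pentagon X.str Y.str Z.str U.str))
    (triangle := fun X Y => hom_ext _ _ (CrossedStructure.assoc_triangle X.str Y.str))

end Crossed

/-- The double category (Drinfeld centre, or category of representations in itself) of the monoidal
category of modules over `k^φ(G)`: the objects are modules `V` with natural isomorphisms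
`λ W : V ⊗ W ≅ W ⊗ V` compatible with the monoidal structure. -/
abbrev ThreeCocycle.Double {k : Type u} {G : Type w} [Field k] [Group G] [Fintype G]
    [DecidableEq G] (φ : ThreeCocycle k G) :=
  Center (QuasiBialgebra.Rep φ.quasiBialgebra)

/-- Given a cocycle crossed module structure on (the vector space underlying) each object of the
double category of modules over `k^φ(G)`, such that each morphism of the double category
preserves these structures, the resulting functor. -/
def functorOfStructure {k : Type u} {G : Type w} [Field k] [Group G] [Fintype G] [DecidableEq G]
    {φ : ThreeCocycle k G}
    (S : ∀ X : φ.Double, CrossedStructure φ X.1.V)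
    (hS : ∀ (X Y : φ.Double) (f : X ⟶ Y),
      IsCrossedHom (S X) (S Y) f.f.lin) :
    φ.Double ⥤ Crossed φ where
  obj X := ⟨X.1.V, S X⟩
  map {X Y} f := ⟨f.f.lin, hS X Y f⟩

/-! A module over $k(G)$ is the same as a $G$-graded vector space: the elements of degree $s$ are
those on which every $f$ acts by $f(s)$. On homogeneous elements the coproduct multiplies degrees
and the associator multiplies by a value of $\phi$.

Let $k_x$ be the one-dimensional module in degree $x$. If $w \in W$ has degree $x$, then $1 \mapsto
w$ is a module map $k_x \to W$, so naturality gives $\lambda_W(v \otimes w) = w \otimes (v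
\triangleleft x)$, where $v \triangleleft x$ is read off from $\lambda_{k_x}(v \otimes 1)$
(`braidLin_tmul`). A half-braiding is thus a family of operators $\triangleleft x$, and its axioms
become the axioms of a cocycle crossed module. Linearity over $k(G)$ says $|v \triangleleft x| =
x^{-1}|v|x$ (`centerAct_mem`). The hexagon at $k_x$, $k_y$ contains three associators, whose scalars
combine to $\chi(x,y)(|v|)$ (`centerAct_centerAct`). Invertibility then forces $v \triangleleft e =
v$ (`centerAct_one`). Conversely, the formula $v \otimes w \mapsto w \otimes (v \triangleleft |w|)$
turns a crossed module into an object of the centre (`halfBraiding`); invertibility holds because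
$\chi$ takes invertible values.

The half-braiding of a tensor product in the centre involves three associators again, now with $x$
in the last, middle and first place; their scalars give the factor $\tau$ in the action on $v
\otimes w$ (`centerStructure_eq_tensor`). Both passages keep vector spaces and linear maps, so the
functor is bijective on objects and fully faithful, and its monoidal structure maps are identities.
-/

/-! ### Cocycle identities for `χ` and `τ` -/

namespace ThreeCocycle

variable {k : Type u} {G : Type w} [Field k] [Group G]

/-- `χ` is an alternating product of values of `φ`, over the three ways of inserting `s`, conjugated
by what it has passed, into the pair `(x, y)`. Its cocycle identity is accordingly the alternating
sum of the four 3-cocycle identities in which `s` is inserted into `(x, y, z)`. -/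
theorem χ_cocycle (φ : ThreeCocycle k G) (x y z s : G) :
    φ.χ y z (x⁻¹ * s * x) * φ.χ x (y * z) s = φ.χ x y s * φ.χ (x * y) z s := by
  -- With `s` written as a conjugate of `a`, all words in the group reduce to a common form by
  -- cancellation alone.
  obtain ⟨a, rfl⟩ : ∃ a, s = x * (y * (z * a * z⁻¹) * y⁻¹) * x⁻¹ :=
    ⟨z⁻¹ * (y⁻¹ * (x⁻¹ * s * x) * y) * z, by group⟩
  have h1 := φ.additive (x * (y * (z * a * z⁻¹) * y⁻¹) * x⁻¹) x y z
  have h2 := φ.additive x (y * (z * a * z⁻¹) * y⁻¹) y z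
  have h3 := φ.additive x y (z * a * z⁻¹) z
  have h4 := φ.additive x y z a
  apply Additive.ofMul.injective
  simp only [χ, ofMul_mul, ofMul_div]
  simp only [mul_assoc, inv_mul_cancel_left, inv_mul_cancel, mul_one, mul_inv_rev] at *
  linear_combination (norm := abel) -h1 + h2 - h3 + h4

theorem χ_one_left (φ : ThreeCocycle k G) (x s : G) : φ.χ 1 x s = 1 := by
  simp [χ, φ.one_left, φ.normalised]

theorem χ_one_right (φ : ThreeCocycle k G) (x s : G) : φ.χ x 1 s = 1 := by
  simp [χ, φ.one_right, φ.normalised]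

/-- The identity making the braiding compatible with the action. -/
theorem τ_mul_χ (φ : ThreeCocycle k G) (s t x : G) :
    φ.τ t (t⁻¹ * s * t) x * φ.χ t x s = φ.τ s t x * φ.χ x (x⁻¹ * t * x) s := by
  -- The cocycle condition plays no role: after cancellation both sides are `φ s t x * φ x (x⁻¹tx)
  -- ((tx)⁻¹s(tx))`.
  apply Additive.ofMul.injective
  simp only [χ, τ, ofMul_mul, ofMul_div]
  simp only [mul_assoc, mul_inv_cancel_left, mul_inv_rev, inv_inv]
  abel

/-- The definition of `χ` without denominators. This is the form met in the hexagon, where the three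
values of `φ` are the scalars of its three associators. -/
theorem χ_mul (φ : ThreeCocycle k G) (x y s : G) :
    φ x (x⁻¹ * s * x) y * φ.χ x y s = φ s x y * φ x y ((x * y)⁻¹ * s * (x * y)) := by
  have h : (x * y)⁻¹ * s * (x * y) = y⁻¹ * x⁻¹ * s * x * y := by group
  rw [χ, h, mul_div_cancel, mul_comm]

/-- The definition of `τ` without denominators, as met in the hexagon that splits the factor on the
left of the braiding. -/
theorem τ_mul_eq (φ : ThreeCocycle k G) (s t x : G) :
    φ s x (x⁻¹ * t * x) * φ.τ s t x = φ s t x * φ x (x⁻¹ * s * x) (x⁻¹ * t * x) := by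
  rw [τ, mul_div_cancel, mul_comm]

end ThreeCocycle

/-! ### Graded vector spaces -/

namespace DirectSum.IsInternal

variable {k : Type u} {G : Type w} [Field k] [DecidableEq G] [Fintype G] {V W Z U : Type*}
  [AddCommGroup V] [Module k V] [AddCommGroup W] [Module k W] [AddCommGroup Z] [Module k Z]
  [AddCommGroup U] [Module k U]
  {A B : G → Submodule k V} {C : G → Submodule k W} {D : G → Submodule k Z}

/-- The `A`-components of `v` are also `B`-components, and those are unique. Hence two gradings of
one space agree as soon as one is contained in the other, which is how gradings are compared below.
-/
theorem mem_of_le (hA : DirectSum.IsInternal A) (hB : DirectSum.IsInternal B)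
    (h : ∀ s, A s ≤ B s) {s : G} {v : V} (hv : v ∈ B s) : v ∈ A s := by
  have h1 : hB.proj s v = hA.proj s v := by
    conv_lhs => rw [← hA.sum_proj v, map_sum]
    rw [Finset.sum_eq_single s]
    · rw [hB.proj_of_mem s (h s (hA.proj_mem s v)), if_pos rfl]
    · intro t _ ht
      rw [hB.proj_of_mem s (h t (hA.proj_mem t v)), if_neg ht]
    · simp
  rw [hB.proj_of_mem s hv, if_pos rfl] at h1
  rw [h1]
  exact hA.proj_mem s v

theorem eq_of_le (hA : DirectSum.IsInternal A) (hB : DirectSum.IsInternal B)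
    (h : ∀ s, A s ≤ B s) : A = B :=
  funext fun s => le_antisymm (h s) fun _ hv => hA.mem_of_le hB h hv

theorem tensor₃_ext (hA : DirectSum.IsInternal A) (hC : DirectSum.IsInternal C)
    (hD : DirectSum.IsInternal D) {f g : (V ⊗[k] W) ⊗[k] Z →ₗ[k] U}
    (hfg : ∀ s t r, ∀ v ∈ A s, ∀ w ∈ C t, ∀ z ∈ D r,
      f ((v ⊗ₜ w) ⊗ₜ z) = g ((v ⊗ₜ w) ⊗ₜ z)) : f = g := by
  refine TensorProduct.ext (hA.tensor_ext hC fun s t v hv w hw => ?_)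
  exact hD.linearMap_ext fun r z hz => hfg s t r v hv w hw z hz

/-- Given a family of endomorphisms `a x` of `V` and a grading on `W`, the map
`v ⊗ w ↦ w ⊗ a x v` for `w` of degree `x`. -/
noncomputable def flip (hC : DirectSum.IsInternal C) (a : G → V →ₗ[k] V) :
    V ⊗[k] W →ₗ[k] W ⊗[k] V :=
  (∑ x, TensorProduct.map (hC.proj x) (a x)) ∘ₗ (TensorProduct.comm k V W).toLinearMap

theorem flip_tmul (hC : DirectSum.IsInternal C) (a : G → V →ₗ[k] V) (v : V) {x : G} {w : W}
    (hw : w ∈ C x) : hC.flip a (v ⊗ₜ w) = w ⊗ₜ a x v := by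
  simp only [flip, LinearMap.comp_apply, LinearEquiv.coe_coe, TensorProduct.comm_tmul,
    LinearMap.sum_apply, TensorProduct.map_tmul]
  rw [Finset.sum_eq_single x]
  · rw [hC.proj_of_mem x hw, if_pos rfl]
  · intro y _ hy
    rw [hC.proj_of_mem y hw, if_neg hy.symm, TensorProduct.zero_tmul]
  · simp

theorem tensorProduct_ext_right (hC : DirectSum.IsInternal C) {f g : V ⊗[k] W →ₗ[k] U}
    (hfg : ∀ x, ∀ v, ∀ w ∈ C x, f (v ⊗ₜ w) = g (v ⊗ₜ w)) : f = g :=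
  TensorProduct.ext (LinearMap.ext fun v => hC.linearMap_ext fun x w hw => hfg x v w hw)

/-- The map `v ⊗ w ↦ w ⊗ a x v` for `w` of degree `x`, with `a x` invertible, as an
equivalence. -/
noncomputable def flipEquiv (hC : DirectSum.IsInternal C) (a : G → V ≃ₗ[k] V) :
    V ⊗[k] W ≃ₗ[k] W ⊗[k] V :=
  LinearEquiv.ofLinearMap (hC.flip fun x => (a x).toLinearMap)
    ((TensorProduct.comm k W V).toLinearMap ∘ₗ
      hC.flip (fun x => (a x).symm.toLinearMap) ∘ₗ (TensorProduct.comm k W V).toLinearMap)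
    (by
      -- Precomposing with the swap puts the graded factor on the right, where
      -- `tensorProduct_ext_right` can test it.
      rw [← LinearMap.cancel_right (TensorProduct.comm k V W).surjective]
      refine hC.tensorProduct_ext_right fun x v w hw => ?_
      simp [hC.flip_tmul _ _ hw])
    (by
      refine hC.tensorProduct_ext_right fun x v w hw => ?_
      simp [hC.flip_tmul _ _ hw])

theorem flipEquiv_tmul (hC : DirectSum.IsInternal C) (a : G → V ≃ₗ[k] V) (v : V) {x : G} {w : W}
    (hw : w ∈ C x) : hC.flipEquiv a (v ⊗ₜ w) = w ⊗ₜ a x v :=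
  hC.flip_tmul _ v hw

/-- The action of functions on `G` on a graded vector space: `f • v = f (|v|) v`. -/
noncomputable def action (hA : DirectSum.IsInternal A) : (G → k) →ₐ[k] Module.End k V :=
  AlgHom.ofLinearMap (∑ s, (LinearMap.proj s : (G → k) →ₗ[k] k).smulRight (hA.proj s))
    (by
      ext v
      simp [LinearMap.sum_apply, hA.sum_proj])
    (by
      intro f g
      refine hA.linearMap_ext fun t v hv => ?_
      simp [LinearMap.sum_apply, hA.proj_of_mem _ hv, mul_smul, smul_comm (f t)])

theorem action_of_mem (hA : DirectSum.IsInternal A) (f : G → k) {s : G} {v : V} (hv : v ∈ A s) :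
    hA.action f v = f s • v := by
  simp [action, LinearMap.sum_apply, hA.proj_of_mem _ hv]

end DirectSum.IsInternal

/-! ### Modules over the functions on `G` as graded spaces -/

namespace FunctionAlgebra

variable {k : Type u} {G : Type w} [Field k] {V W Z : Type u} [AddCommGroup V] [Module k V]
  [AddCommGroup W] [Module k W] [AddCommGroup Z] [Module k Z]

/-- The subspace on which functions on `G` act by evaluation at `s`. -/
def component (ρ : (G → k) →ₐ[k] Module.End k V) (s : G) : Submodule k V where
  carrier := {v | ∀ f : G → k, ρ f v = f s • v}
  zero_mem' f := by simp
  add_mem' ha hb f := by rw [map_add, ha f, hb f, smul_add]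
  smul_mem' c a ha f := by rw [map_smul, ha f, smul_comm]

variable [DecidableEq G] [Fintype G]

/-- The delta functions are orthogonal idempotents with sum `1`, so they act as the projections of a
grading. -/
theorem isInternal_component (ρ : (G → k) →ₐ[k] Module.End k V) :
    DirectSum.IsInternal (component ρ) := by
  refine DirectSum.IsInternal.of_proj (fun s => ρ (Pi.single s 1)) ?_ ?_ ?_
  · intro s v f
    have h : f * Pi.single s 1 = f s • (Pi.single s 1 : G → k) := by
      ext t
      by_cases h : t = s
      · subst h; simp
      · simp [h]
    rw [← Module.End.mul_apply, ← map_mul, h, map_smul, LinearMap.smul_apply]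
  · intro s t v hv
    rw [hv, Pi.single_apply]
    split_ifs <;> simp
  · intro v
    have h : ∑ s, (Pi.single s 1 : G → k) = 1 := Finset.univ_sum_single (1 : G → k)
    rw [← LinearMap.sum_apply, ← map_sum, h, map_one, Module.End.one_apply]

theorem action_component (ρ : (G → k) →ₐ[k] Module.End k V) :
    (isInternal_component ρ).action = ρ :=
  AlgHom.ext fun f => (isInternal_component ρ).linearMap_ext fun s v hv => by
    rw [(isInternal_component ρ).action_of_mem f hv, hv f]

theorem component_action {A : G → Submodule k V} (hA : DirectSum.IsInternal A) :
    component hA.action = A :=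
  (hA.eq_of_le (isInternal_component hA.action) fun _ _ hv f => hA.action_of_mem f hv).symm

end FunctionAlgebra

/-! ### Tensor products and associators on homogeneous elements -/

namespace ThreeCocycle

open FunctionAlgebra

variable {k : Type u} {G : Type w} [Field k] [Group G] [Fintype G] [DecidableEq G]
  (φ : ThreeCocycle k G) {V W Z : Type u} [AddCommGroup V] [Module k V]
  [AddCommGroup W] [Module k W] [AddCommGroup Z] [Module k Z]
  {ρV : (G → k) →ₐ[k] Module.End k V} {ρW : (G → k) →ₐ[k] Module.End k W}
  {ρZ : (G → k) →ₐ[k] Module.End k Z}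

/-- In `Δ f = ∑ f (x y) δ_x ⊗ δ_y` only the terms with `x = s` survive. Nothing is required of `w`,
because `centerAct_mem` applies this to an element whose degree is still to be found. -/
theorem tensorAct_tmul_of_mem_left (f : G → k) {s : G} {v : V} (hv : v ∈ component ρV s) (w : W) :
    φ.quasiBialgebra.tensorAct ρV ρW f (v ⊗ₜ w) = v ⊗ₜ ρW (fun y => f (s * y)) w := by
  have h : (fun y => f (s * y)) = ∑ y, f (s * y) • (Pi.single y (1 : k) : G → k) := by
    ext y
    simp [Pi.single_apply]
  rw [QuasiBialgebra.tensorAct_apply]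
  change QuasiBialgebra.act₂ ρV ρW (comul k G f) (v ⊗ₜ w) = _
  rw [comul_apply, h]
  simp only [map_sum, map_smul, LinearMap.sum_apply, LinearMap.smul_apply,
    QuasiBialgebra.act₂_tmul, TensorProduct.tmul_sum]
  rw [Finset.sum_eq_single s]
  · simp [hv (Pi.single s 1)]
  · intro x _ hx
    simp [hv (Pi.single x 1), hx.symm]
  · simp

theorem tmul_mem_component {s t : G} {v : V} {w : W} (hv : v ∈ component ρV s)
    (hw : w ∈ component ρW t) :
    v ⊗ₜ w ∈ component (φ.quasiBialgebra.tensorAct ρV ρW) (s * t) := by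
  intro f
  rw [φ.tensorAct_tmul_of_mem_left f hv, hw, TensorProduct.tmul_smul]

theorem tensorGrading_component : tensorGrading (component ρV) (component ρW) =
    component (φ.quasiBialgebra.tensorAct ρV ρW) := by
  refine ((isInternal_component ρV).tensor (isInternal_component ρW)).eq_of_le
    (isInternal_component _) fun r => Submodule.span_le.2 ?_
  rintro _ ⟨s, t, v, w, hv, hw, rfl, rfl⟩
  exact φ.tmul_mem_component hv hw

/-- Of the sum defining `Φ`, only the term at `(s, t, r)` acts nontrivially. -/
theorem assocEquiv_tmul {s t r : G} {v : V} {w : W} {z : Z} (hv : v ∈ component ρV s)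
    (hw : w ∈ component ρW t) (hz : z ∈ component ρZ r) :
    φ.quasiBialgebra.assocEquiv ρV ρW ρZ ((v ⊗ₜ w) ⊗ₜ z) = (φ s t r : k) • (v ⊗ₜ (w ⊗ₜ z)) := by
  rw [QuasiBialgebra.assocEquiv_apply, TensorProduct.assoc_tmul]
  change QuasiBialgebra.act₃ ρV ρW ρZ (tensor₃ fun x y z => (φ x y z : k)) _ = _
  simp only [tensor₃, map_sum, map_smul, LinearMap.sum_apply, LinearMap.smul_apply,
    QuasiBialgebra.act₂_tmul, hv (Pi.single _ 1), hw (Pi.single _ 1), hz (Pi.single _ 1)]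
  rw [Finset.sum_eq_single s, Finset.sum_eq_single t, Finset.sum_eq_single r]
  · simp
  · intro r' _ hr
    simp [hr.symm]
  · simp
  · intro t' _ ht
    simp [Pi.single_apply, ht.symm]
  · simp
  · intro s' _ hs
    simp [Pi.single_apply, hs.symm]
  · simp

end ThreeCocycle

/-! ### From half-braidings to crossed module structures -/

namespace ThreeCocycle

open FunctionAlgebra

variable {k : Type u} {G : Type w} [Field k]

/-- The one-dimensional module on which functions act by evaluation at `x`. -/
noncomputable def pointAct (k : Type u) {G : Type w} [Field k] (x : G) :
    (G → k) →ₐ[k] Module.End k k :=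
  (Algebra.lmul k k).comp (Pi.evalAlgHom k (fun _ : G => k) x)

theorem mem_component_pointAct (x : G) (c : k) : c ∈ component (pointAct k x) x := fun _ => rfl

variable [Group G] [Fintype G] [DecidableEq G] (φ : ThreeCocycle k G)
  {V W W' : Type u} [AddCommGroup V] [Module k V] [AddCommGroup W] [Module k W]
  [AddCommGroup W'] [Module k W']

/-- The object of the category of modules given by an action. -/
abbrev rep (ρ : (G → k) →ₐ[k] Module.End k V) : QuasiBialgebra.Rep φ.quasiBialgebra := ⟨V, ρ⟩

variable {φ}
variable {ρV : (G → k) →ₐ[k] Module.End k V} (b : HalfBraiding (φ.rep ρV))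
  (ρW : (G → k) →ₐ[k] Module.End k W) (ρW' : (G → k) →ₐ[k] Module.End k W')

/-- The linear map underlying a half-braiding. -/
def braidLin : V ⊗[k] W →ₗ[k] W ⊗[k] V :=
  (b.β (φ.rep ρW)).hom.lin

theorem braidLin_natural (f : W →ₗ[k] W') (hf : ∀ h w, f (ρW h w) = ρW' h (f w))
    (v : V ⊗[k] W) : braidLin b ρW' (TensorProduct.map LinearMap.id f v) =
      TensorProduct.map f LinearMap.id (braidLin b ρW v) :=
  congrArg (fun f => QuasiBialgebra.Rep.Hom.lin f v)
    (b.naturality (U := φ.rep ρW) (U' := φ.rep ρW') ⟨f, hf⟩)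

theorem braidLin_act (f : G → k) (v : V ⊗[k] W) :
    braidLin b ρW (φ.quasiBialgebra.tensorAct ρV ρW f v) =
      φ.quasiBialgebra.tensorAct ρW ρV f (braidLin b ρW v) :=
  (b.β (φ.rep ρW)).hom.comm f v

theorem braidLin_injective : Function.Injective (braidLin b ρW) := by
  intro v w h
  have h1 := fun v => congrArg (fun f => QuasiBialgebra.Rep.Hom.lin f v)
    (b.β (φ.rep ρW)).hom_inv_id
  exact (h1 v).symm.trans ((congrArg (b.β (φ.rep ρW)).inv.lin h).trans (h1 w))

/-- The hexagon, with associators moved across so that `Φ⁻¹` does not occur. -/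
theorem braidLin_tensor (v : (V ⊗[k] W) ⊗[k] W') :
    φ.quasiBialgebra.assocEquiv ρW ρW' ρV (braidLin b (φ.quasiBialgebra.tensorAct ρW ρW')
      (φ.quasiBialgebra.assocEquiv ρV ρW ρW' v)) =
      TensorProduct.map LinearMap.id (braidLin b ρW') (φ.quasiBialgebra.assocEquiv ρW ρV ρW'
        (TensorProduct.map (braidLin b ρW) LinearMap.id v)) := by
  have h : (α_ (φ.rep ρV) (φ.rep ρW) (φ.rep ρW')).hom ≫
      (b.β (φ.rep ρW ⊗ φ.rep ρW')).hom ≫ (α_ (φ.rep ρW) (φ.rep ρW') (φ.rep ρV)).hom =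
      (b.β (φ.rep ρW)).hom ▷ (φ.rep ρW') ≫ (α_ (φ.rep ρW) (φ.rep ρV) (φ.rep ρW')).hom ≫
        (φ.rep ρW) ◁ (b.β (φ.rep ρW')).hom := by
    rw [b.monoidal]
    simp
  exact congrArg (fun f => QuasiBialgebra.Rep.Hom.lin f v) h

/-- The action of `x` is the half-braiding with the one-dimensional module at `x`. -/
noncomputable def centerAct (x : G) : V →ₗ[k] V :=
  (TensorProduct.lid k V).toLinearMap ∘ₗ braidLin b (pointAct k x) ∘ₗ
    (TensorProduct.rid k V).symm.toLinearMap

theorem braidLin_point (x : G) (v : V) :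
    braidLin b (pointAct k x) (v ⊗ₜ (1 : k)) = (1 : k) ⊗ₜ centerAct b x v := by
  apply (TensorProduct.lid k V).injective
  rw [TensorProduct.lid_tmul, one_smul]
  rfl

variable {ρW} in
-- Naturality along the module map from the one-dimensional module at `x` to `W` that sends `1` to
-- `w`. This is why a half-braiding is determined by its values on one-dimensional modules.
theorem braidLin_tmul {x : G} (v : V) {w : W} (hw : w ∈ component ρW x) :
    braidLin b ρW (v ⊗ₜ w) = w ⊗ₜ centerAct b x v := by
  have h := braidLin_natural b (pointAct k x) ρW (LinearMap.toSpanSingleton k W w)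
    (fun f c => by
      change (f x * c) • w = ρW f (c • w)
      rw [map_smul, hw, smul_smul, mul_comm]) (v ⊗ₜ (1 : k))
  simpa [braidLin_point] using h

theorem centerAct_injective (x : G) : Function.Injective (centerAct b x) :=
  (TensorProduct.lid k V).injective.comp
    ((braidLin_injective b _).comp (TensorProduct.rid k V).symm.injective)

theorem centerAct_mem (x : G) {s : G} {v : V} (hv : v ∈ component ρV s) :
    centerAct b x v ∈ component ρV (x⁻¹ * s * x) := by
  intro f
  -- The translate of `f` is chosen so that, on the other side of the braiding, the degree `x` of
  -- `1` cancels and `f` itself acts on `centerAct b x v`. On `v ⊗ 1`, of degree `s * x`, it acts by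
  -- `f (x⁻¹ * s * x)`.
  have h := braidLin_act b (pointAct k x) (fun y => f (x⁻¹ * y)) (v ⊗ₜ (1 : k))
  rw [φ.tmul_mem_component hv (mem_component_pointAct x 1), map_smul, braidLin_point,
    φ.tensorAct_tmul_of_mem_left _ (mem_component_pointAct x 1)] at h
  simpa [mul_assoc] using (congrArg (TensorProduct.lid k V) h).symm

/-- The hexagon on `v ⊗ 1 ⊗ 1` for the one-dimensional modules at `x` and `y`: in their tensor
product `1 ⊗ 1` has degree `x * y`, so braiding past it gives `centerAct b (x * y)`. The associators
contribute the three factors of `χ_mul`. -/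
theorem centerAct_centerAct (x y : G) {s : G} {v : V} (hv : v ∈ component ρV s) :
    centerAct b y (centerAct b x v) = (φ.χ x y s : k) • centerAct b (x * y) v := by
  have hx := mem_component_pointAct x (1 : k)
  have hy := mem_component_pointAct y (1 : k)
  have h := braidLin_tensor b (pointAct k x) (pointAct k y) ((v ⊗ₜ (1 : k)) ⊗ₜ (1 : k))
  rw [φ.assocEquiv_tmul hv hx hy, TensorProduct.map_tmul, braidLin_point, map_smul, map_smul,
    LinearMap.id_apply, φ.assocEquiv_tmul hx (centerAct_mem b x hv) hy, map_smul,
    TensorProduct.map_tmul, braidLin_point,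
    braidLin_tmul b v (φ.tmul_mem_component hx hy),
    φ.assocEquiv_tmul hx hy (centerAct_mem b (x * y) hv), LinearMap.id_apply] at h
  have h2 := congrArg (fun u => TensorProduct.lid k V (TensorProduct.lid k (k ⊗[k] V) u)) h
  simp only [map_smul, TensorProduct.lid_tmul, one_smul, smul_smul] at h2
  have h3 := congrArg (Units.val : kˣ → k) (φ.χ_mul x y s)
  simp only [Units.val_mul] at h3
  -- The invertible scalar of the middle associator, the denominator of `χ`, is cancelled.
  apply smul_right_injective V (φ x (x⁻¹ * s * x) y).ne_zero
  simp only
  rw [smul_smul, h3, ← h2]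

/-- Since `χ 1 1 = 1`, the operator `centerAct b 1` is idempotent; being injective, it is the
identity. -/
theorem centerAct_one (v : V) : centerAct b 1 v = v := by
  refine LinearMap.congr_fun (g := LinearMap.id)
    ((isInternal_component ρV).linearMap_ext fun s v hv => ?_) v
  apply centerAct_injective b 1
  rw [centerAct_centerAct b 1 1 hv, χ_one_left]
  simp

/-- The cocycle crossed module structure given by a half-braiding. -/
noncomputable def centerStructure : CrossedStructure φ V where
  grading := component ρV
  isInternal := isInternal_component ρV
  act := centerAct b
  act_act x y _ _ hv := centerAct_centerAct b x y hv
  act_one := centerAct_one b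
  act_mem x _ _ hv := centerAct_mem b x hv

/-- Compatibility with the half-braidings on one-dimensional modules is enough, since the action is
defined by them. -/
theorem isCrossedHom_centerStructure {ρW : (G → k) →ₐ[k] Module.End k W}
    (c : HalfBraiding (φ.rep ρW)) {f : V →ₗ[k] W} (h1 : ∀ h v, f (ρV h v) = ρW h (f v))
    (h2 : ∀ x v, braidLin c (pointAct k x) (TensorProduct.map f LinearMap.id v) =
      TensorProduct.map LinearMap.id f (braidLin b (pointAct k x) v)) :
    IsCrossedHom (centerStructure b) (centerStructure c) f where
  map_mem s v hv g := by rw [← h1, hv g, map_smul]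
  map_act x v := by
    have h := h2 x (v ⊗ₜ (1 : k))
    rw [TensorProduct.map_tmul, LinearMap.id_apply, braidLin_point, braidLin_point,
      TensorProduct.map_tmul] at h
    change f (centerAct b x v) = centerAct c x (f v)
    simpa using (congrArg (TensorProduct.lid k W) h).symm

end ThreeCocycle

namespace CrossedStructure

variable {k : Type u} {G : Type w} [Field k] [Group G] [Fintype G] [DecidableEq G]
  {φ : ThreeCocycle k G} {V : Type*} [AddCommGroup V] [Module k V]

theorem eq_of_grading_le {S T : CrossedStructure φ V} (h : ∀ s, S.grading s ≤ T.grading s)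
    (h' : ∀ x s, ∀ v ∈ S.grading s, S.act x v = T.act x v) : S = T := by
  have h1 := S.isInternal.eq_of_le T.isInternal h
  have h2 : S.act = T.act := funext fun x => S.isInternal.linearMap_ext (h' x)
  cases S
  cases T
  simp_all

end CrossedStructure

/-! ### The tensor product and unit of the double category -/

namespace ThreeCocycle

open FunctionAlgebra

variable {k : Type u} {G : Type w} [Field k] [Group G] [Fintype G] [DecidableEq G]
  {φ : ThreeCocycle k G} {V W : Type u} [AddCommGroup V] [Module k V] [AddCommGroup W]
  [Module k W] {ρV : (G → k) →ₐ[k] Module.End k V} {ρW : (G → k) →ₐ[k] Module.End k W}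

/-- The hypothesis `hd` is the formula for the half-braiding of a tensor product in the centre. Its
associators contribute `φ s t x`, the inverse of `φ s x (x⁻¹tx)` and `φ x (x⁻¹sx) (x⁻¹tx)`, whose
product is `τ`. -/
theorem centerStructure_eq_tensor (b : HalfBraiding (φ.rep ρV)) (c : HalfBraiding (φ.rep ρW))
    (d : HalfBraiding (φ.rep (φ.quasiBialgebra.tensorAct ρV ρW)))
    (hd : ∀ x v, braidLin d (pointAct k x) v =
      φ.quasiBialgebra.assocEquiv (pointAct k x) ρV ρW
        (TensorProduct.map (braidLin b (pointAct k x)) LinearMap.id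
          ((φ.quasiBialgebra.assocEquiv ρV (pointAct k x) ρW).symm
            (TensorProduct.map LinearMap.id (braidLin c (pointAct k x))
              (φ.quasiBialgebra.assocEquiv ρV ρW (pointAct k x) v))))) :
    centerStructure d = (centerStructure b).tensor (centerStructure c) := by
  symm
  refine CrossedStructure.eq_of_grading_le
    (fun s => le_of_eq (congrFun φ.tensorGrading_component s)) fun x => ?_
  suffices h : ((centerStructure b).tensor (centerStructure c)).act x =
      (centerStructure d).act x from fun s v _ => LinearMap.congr_fun h v
  refine (centerStructure b).isInternal.tensor_ext (centerStructure c).isInternal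
    fun s t v hv w hw => ?_
  rw [CrossedStructure.tensor_act_tmul _ _ x hv hw]
  change v ∈ component ρV s at hv
  change w ∈ component ρW t at hw
  change _ • (centerAct b x v ⊗ₜ[k] centerAct c x w) = centerAct d x (v ⊗ₜ w)
  have hx := mem_component_pointAct x (1 : k)
  have hy := centerAct_mem c x hw
  have ha : (φ.quasiBialgebra.assocEquiv ρV (pointAct k x) ρW).symm
      (v ⊗ₜ ((1 : k) ⊗ₜ centerAct c x w)) =
      (((φ s x (x⁻¹ * t * x))⁻¹ : kˣ) : k) • ((v ⊗ₜ (1 : k)) ⊗ₜ centerAct c x w) := by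
    rw [LinearEquiv.symm_apply_eq, map_smul, φ.assocEquiv_tmul hv hx hy, smul_smul, Units.inv_mul,
      one_smul]
  have h := hd x ((v ⊗ₜ w) ⊗ₜ (1 : k))
  rw [braidLin_point, φ.assocEquiv_tmul hv hw hx, map_smul, map_smul, TensorProduct.map_tmul,
    braidLin_point, LinearMap.id_apply, ha, map_smul, map_smul, map_smul, map_smul,
    TensorProduct.map_tmul, braidLin_point, LinearMap.id_apply,
    φ.assocEquiv_tmul hx (centerAct_mem b x hv) hy] at h
  have h2 := congrArg (TensorProduct.lid k (V ⊗[k] W)) h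
  simp only [map_smul, TensorProduct.lid_tmul, one_smul, smul_smul] at h2
  rw [h2]
  have h3 := congrArg (Units.val : kˣ → k) (φ.τ_mul_eq s t x)
  simp only [Units.val_mul] at h3
  congr 1
  rw [mul_left_comm, ← h3, Units.inv_mul_cancel_left]

theorem centerStructure_eq_unit (d : HalfBraiding (φ.rep φ.quasiBialgebra.unitAct))
    (hd : ∀ x (c c' : k), braidLin d (pointAct k x) (c ⊗ₜ c') = (c * c') ⊗ₜ (1 : k)) :
    centerStructure d = CrossedStructure.unit φ := by
  symm
  refine CrossedStructure.eq_of_grading_le (fun s c hc => ?_) fun x s c hc => ?_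
  · rcases CrossedStructure.mem_unit hc with rfl | rfl
    · intro f
      rfl
    · exact zero_mem _
  · change c = TensorProduct.lid k k (braidLin d (pointAct k x) (c ⊗ₜ (1 : k)))
    rw [hd]
    simp

theorem double_tensor_structure (X Y : φ.Double) :
    centerStructure (φ := φ) (ρV := (X ⊗ Y).1.ρ) (X ⊗ Y).2 =
      (centerStructure (φ := φ) (ρV := X.1.ρ) X.2).tensor
        (centerStructure (φ := φ) (ρV := Y.1.ρ) Y.2) :=
  centerStructure_eq_tensor (ρV := X.1.ρ) (ρW := Y.1.ρ) X.2 Y.2 (X ⊗ Y).2 fun _ _ => rfl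

theorem double_unit_structure :
    centerStructure (φ := φ) (ρV := (𝟙_ φ.Double).1.ρ) (𝟙_ φ.Double).2 =
      CrossedStructure.unit φ :=
  centerStructure_eq_unit (𝟙_ φ.Double).2 fun x c c' => by
    change (TensorProduct.rid k k).symm (TensorProduct.lid k k (c ⊗ₜ c')) = _
    simp

theorem double_isCrossedHom {X Y : φ.Double} (f : X ⟶ Y) :
    IsCrossedHom (centerStructure (φ := φ) (ρV := X.1.ρ) X.2)
      (centerStructure (φ := φ) (ρV := Y.1.ρ) Y.2) f.f.lin :=
  isCrossedHom_centerStructure (φ := φ) (ρV := X.1.ρ) X.2 (ρW := Y.1.ρ) Y.2 f.f.comm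
    fun x v => congrArg (fun g => QuasiBialgebra.Rep.Hom.lin g v) (f.comm (φ.rep (pointAct k x)))

end ThreeCocycle

/-! ### The braiding of crossed modules -/

namespace CrossedStructure

variable {k : Type u} {G : Type w} [Field k] [Group G] [Fintype G] [DecidableEq G]
  {φ : ThreeCocycle k G} {V W Z : Type*} [AddCommGroup V] [Module k V] [AddCommGroup W]
  [Module k W] [AddCommGroup Z] [Module k Z]
  (S : CrossedStructure φ V) (T : CrossedStructure φ W) (R : CrossedStructure φ Z)

/-- On degree `s`, acting by `x` and then by `x⁻¹` is multiplication by the nonzero scalar `χ x x⁻¹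
s`. This scalar depends on `s`, so the argument runs over homogeneous components. -/
theorem act_injective (x : G) : Function.Injective (S.act x) := by
  refine (injective_iff_map_eq_zero _).2 fun v hv => ?_
  rw [← S.isInternal.sum_proj v]
  refine Finset.sum_eq_zero fun s _ => ?_
  have h : (LinearMap.lsmul k V (φ.χ x x⁻¹ s : k)) ∘ₗ S.isInternal.proj s =
      S.isInternal.proj s ∘ₗ S.act x⁻¹ ∘ₗ S.act x := by
    refine S.isInternal.linearMap_ext fun t v hv => ?_
    simp only [LinearMap.comp_apply, S.act_act x x⁻¹ t v hv, mul_inv_cancel, S.act_one, map_smul,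
      S.isInternal.proj_of_mem s hv, LinearMap.lsmul_apply]
    split_ifs with h
    · rw [h]
    · simp
  have h1 := LinearMap.congr_fun h v
  simpa [hv] using h1

theorem act_surjective (x : G) : Function.Surjective (S.act x) := by
  rw [← LinearMap.range_eq_top, eq_top_iff]
  intro v _
  rw [← S.isInternal.sum_proj v]
  refine Submodule.sum_mem _ fun s _ => ⟨(((φ.χ x⁻¹ x s)⁻¹ : kˣ) : k) •
    S.act x⁻¹ (S.isInternal.proj s v), ?_⟩
  rw [map_smul, S.act_act x⁻¹ x s _ (S.isInternal.proj_mem s v), inv_mul_cancel, S.act_one,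
    smul_smul, Units.inv_mul, one_smul]

/-- The action of `x` as a linear equivalence. -/
noncomputable def actEquiv (x : G) : V ≃ₗ[k] V :=
  LinearEquiv.ofBijective (S.act x) ⟨S.act_injective x, S.act_surjective x⟩

/-- The braiding `v ⊗ w ↦ w ⊗ (v ◁ |w|)`. -/
noncomputable def braid : V ⊗[k] W ≃ₗ[k] W ⊗[k] V :=
  T.isInternal.flipEquiv S.actEquiv

theorem braid_tmul (v : V) {t : G} {w : W} (hw : w ∈ T.grading t) :
    S.braid T (v ⊗ₜ w) = w ⊗ₜ S.act t v :=
  T.isInternal.flipEquiv_tmul _ v hw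

/-- Degrees match because `s t = t (t⁻¹ s t)`. Compatibility with the action is `τ_mul_χ`. -/
theorem isCrossedHom_braid :
    IsCrossedHom (S.tensor T) (T.tensor S) (S.braid T).toLinearMap := by
  refine isCrossedHom_tensor S T _ (fun s t v hv w hw => ?_) fun x s t v hv w hw => ?_
  · rw [LinearEquiv.coe_coe, braid_tmul S T v hw]
    have h : s * t = t * (t⁻¹ * s * t) := by group
    rw [h]
    exact tmul_mem T S hw (S.act_mem t s v hv)
  · rw [LinearEquiv.coe_coe, braid_tmul S T v hw, braid_tmul S T _ (T.act_mem x t w hw),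
      tensor_act_tmul T S x hw (S.act_mem t s v hv), S.act_act _ _ s v hv, S.act_act _ _ s v hv,
      TensorProduct.tmul_smul, TensorProduct.tmul_smul, smul_smul, smul_smul]
    have h := congrArg (Units.val : kˣ → k) (φ.τ_mul_χ s t x)
    simp only [Units.val_mul] at h
    have h1 : x * (x⁻¹ * t * x) = t * x := by group
    rw [h, h1]

theorem braid_natural {V' W' : Type*} [AddCommGroup V'] [Module k V'] [AddCommGroup W']
    [Module k W'] {S' : CrossedStructure φ V'} {T' : CrossedStructure φ W'} {f : V →ₗ[k] V'}
    {g : W →ₗ[k] W'} (hf : IsCrossedHom S S' f) (hg : IsCrossedHom T T' g) :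
    (S'.braid T').toLinearMap ∘ₗ TensorProduct.map f g =
      TensorProduct.map g f ∘ₗ (S.braid T).toLinearMap := by
  refine T.isInternal.tensorProduct_ext_right fun x v w hw => ?_
  simp only [LinearMap.comp_apply, LinearEquiv.coe_coe, TensorProduct.map_tmul]
  rw [braid_tmul S T v hw, braid_tmul S' T' _ (hg.map_mem x w hw), TensorProduct.map_tmul,
    hf.map_act]

/-- On homogeneous elements the scalars on the two sides are those of `χ_mul`. -/
theorem braid_hexagon_forward :
    (T.assoc R S).toLinearMap ∘ₗ (S.braid (T.tensor R)).toLinearMap ∘ₗ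
        (S.assoc T R).toLinearMap =
      TensorProduct.map LinearMap.id (S.braid R).toLinearMap ∘ₗ (T.assoc S R).toLinearMap ∘ₗ
        TensorProduct.map (S.braid T).toLinearMap LinearMap.id := by
  refine tensor₃_ext S T R fun s x y v hv w hw z hz => ?_
  simp only [LinearMap.comp_apply, LinearEquiv.coe_coe, TensorProduct.map_tmul, LinearMap.id_apply]
  rw [assoc_tmul S T R hv hw hz, map_smul, map_smul, braid_tmul S _ v (tmul_mem T R hw hz),
    assoc_tmul T R S hw hz (S.act_mem _ s v hv), braid_tmul S T v hw,
    assoc_tmul T S R hw (S.act_mem x s v hv) hz, map_smul, TensorProduct.map_tmul,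
    LinearMap.id_apply, LinearEquiv.coe_coe, braid_tmul S R _ hz, S.act_act x y s v hv,
    TensorProduct.tmul_smul, TensorProduct.tmul_smul, smul_smul, smul_smul]
  have h := congrArg (Units.val : kˣ → k) (φ.χ_mul x y s)
  simp only [Units.val_mul] at h
  rw [h]

/-- On homogeneous elements this is `τ_mul_eq`: the factor in the tensor product action is exactly
what this hexagon demands. -/
theorem braid_hexagon_reverse :
    TensorProduct.map (S.braid R).toLinearMap LinearMap.id ∘ₗ (S.assoc R T).symm.toLinearMap ∘ₗ
      TensorProduct.map LinearMap.id (T.braid R).toLinearMap ∘ₗ (S.assoc T R).toLinearMap =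
      (R.assoc S T).symm.toLinearMap ∘ₗ ((S.tensor T).braid R).toLinearMap := by
  refine tensor₃_ext S T R fun s t x v hv w hw z hz => ?_
  simp only [LinearMap.comp_apply, LinearEquiv.coe_coe]
  have h1 : (S.assoc R T).symm (v ⊗ₜ (z ⊗ₜ T.act x w)) =
      (((φ s x (x⁻¹ * t * x))⁻¹ : kˣ) : k) • ((v ⊗ₜ z) ⊗ₜ T.act x w) := by
    rw [LinearEquiv.symm_apply_eq, map_smul, assoc_tmul S R T hv hz (T.act_mem x t w hw), smul_smul,
      Units.inv_mul, one_smul]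
  rw [LinearEquiv.eq_symm_apply, braid_tmul _ R _ hz, tensor_act_tmul S T x hv hw,
    assoc_tmul S T R hv hw hz, map_smul, TensorProduct.map_tmul, LinearMap.id_apply,
    LinearEquiv.coe_coe, braid_tmul T R w hz, map_smul, h1, map_smul, map_smul, map_smul, map_smul,
    TensorProduct.map_tmul, LinearMap.id_apply, LinearEquiv.coe_coe, braid_tmul S R v hz,
    assoc_tmul R S T hz (S.act_mem x s v hv) (T.act_mem x t w hw), TensorProduct.tmul_smul,
    smul_smul, smul_smul]
  have h := congrArg (Units.val : kˣ → k) (φ.τ_mul_eq s t x)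
  simp only [Units.val_mul] at h
  rw [mul_right_comm, ← h, mul_right_comm, Units.mul_inv, one_mul]

end CrossedStructure

namespace Crossed

variable {k : Type u} {G : Type w} [Field k] [Group G] [Fintype G] [DecidableEq G]
  {φ : ThreeCocycle k G}

/-- The braiding of the category of cocycle crossed modules. -/
noncomputable def braiding (X Y : Crossed φ) : X ⊗ Y ≅ Y ⊗ X :=
  mkIso (X := tensor X Y) (Y := tensor Y X) (X.str.braid Y.str) (X.str.isCrossedHom_braid Y.str)

noncomputable instance : BraidedCategory (Crossed φ) where
  braiding := braiding
  braiding_naturality_right X _ _ f := hom_ext _ _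
    (CrossedStructure.braid_natural X.str _ (𝟙 X : X ⟶ X).isCrossedHom f.isCrossedHom)
  braiding_naturality_left f Z := hom_ext _ _
    (CrossedStructure.braid_natural _ Z.str f.isCrossedHom (𝟙 Z : Z ⟶ Z).isCrossedHom)
  hexagon_forward X Y Z := hom_ext _ _
    (CrossedStructure.braid_hexagon_forward X.str Y.str Z.str)
  hexagon_reverse X Y Z := by
    -- Composing with the associator lets the identity be tested on elements `(v ⊗ w) ⊗ z`.
    rw [← cancel_epi (α_ X Y Z).hom, Iso.hom_inv_id_assoc]
    exact (hom_ext _ _ (CrossedStructure.braid_hexagon_reverse X.str Y.str Z.str)).symm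

end Crossed

/-! ### From crossed module structures to half-braidings -/

namespace CrossedStructure

open FunctionAlgebra ThreeCocycle

variable {k : Type u} {G : Type w} [Field k] [Group G] [Fintype G] [DecidableEq G]
  {φ : ThreeCocycle k G} {V W W' : Type u} [AddCommGroup V] [Module k V] [AddCommGroup W]
  [Module k W] [AddCommGroup W'] [Module k W']
  (S : CrossedStructure φ V) (ρW : (G → k) →ₐ[k] Module.End k W)
  (ρW' : (G → k) →ₐ[k] Module.End k W')

/-- The action of functions on `G` given by the grading. -/
noncomputable abbrev ρ : (G → k) →ₐ[k] Module.End k V := S.isInternal.action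

theorem mem_component {s : G} {v : V} (hv : v ∈ S.grading s) : v ∈ component S.ρ s :=
  fun f => S.isInternal.action_of_mem f hv

/-- The half-braiding `v ⊗ w ↦ w ⊗ (v ◁ |w|)` with a module. -/
noncomputable def repBraid : V ⊗[k] W ≃ₗ[k] W ⊗[k] V :=
  (isInternal_component ρW).flipEquiv S.actEquiv

variable {ρW} in
theorem repBraid_tmul (v : V) {t : G} {w : W} (hw : w ∈ component ρW t) :
    S.repBraid ρW (v ⊗ₜ w) = w ⊗ₜ S.act t v :=
  (isInternal_component ρW).flipEquiv_tmul _ v hw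

theorem repBraid_act (f : G → k) (v : V ⊗[k] W) :
    S.repBraid ρW (φ.quasiBialgebra.tensorAct S.ρ ρW f v) =
      φ.quasiBialgebra.tensorAct ρW S.ρ f (S.repBraid ρW v) := by
  refine LinearMap.congr_fun (f := (S.repBraid ρW).toLinearMap ∘ₗ
    φ.quasiBialgebra.tensorAct S.ρ ρW f)
    (g := φ.quasiBialgebra.tensorAct ρW S.ρ f ∘ₗ (S.repBraid ρW).toLinearMap) ?_ v
  refine S.isInternal.tensor_ext (isInternal_component ρW) fun s t v hv w hw => ?_
  simp only [LinearMap.comp_apply, LinearEquiv.coe_coe]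
  rw [φ.tmul_mem_component (S.mem_component hv) hw, map_smul, S.repBraid_tmul v hw,
    φ.tmul_mem_component hw (S.mem_component (S.act_mem t s v hv))]
  congr 2
  group

/-- A module map preserves degrees, and the half-braiding depends on `w` only through its degree. -/
theorem repBraid_natural (f : W →ₗ[k] W') (hf : ∀ h w, f (ρW h w) = ρW' h (f w)) :
    (S.repBraid ρW').toLinearMap ∘ₗ TensorProduct.map LinearMap.id f =
      TensorProduct.map f LinearMap.id ∘ₗ (S.repBraid ρW).toLinearMap := by
  refine (isInternal_component ρW).tensorProduct_ext_right fun x v w hw => ?_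
  have hw' : f w ∈ component ρW' x := fun h => by rw [← hf, hw h, map_smul]
  simp only [LinearMap.comp_apply, LinearEquiv.coe_coe, TensorProduct.map_tmul]
  rw [S.repBraid_tmul v hw, S.repBraid_tmul _ hw', TensorProduct.map_tmul]
  rfl

/-- The computation of `braid_hexagon_forward`, for factors `W` and `W'` that carry a grading but no
action of `G`. -/
theorem repBraid_tensor :
    (φ.quasiBialgebra.assocEquiv ρW ρW' S.ρ).toLinearMap ∘ₗ
      (S.repBraid (φ.quasiBialgebra.tensorAct ρW ρW')).toLinearMap ∘ₗ
        (φ.quasiBialgebra.assocEquiv S.ρ ρW ρW').toLinearMap =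
      TensorProduct.map LinearMap.id (S.repBraid ρW').toLinearMap ∘ₗ
        (φ.quasiBialgebra.assocEquiv ρW S.ρ ρW').toLinearMap ∘ₗ
          TensorProduct.map (S.repBraid ρW).toLinearMap LinearMap.id := by
  refine S.isInternal.tensor₃_ext (isInternal_component ρW) (isInternal_component ρW')
    fun s x y v hv w hw z hz => ?_
  have hv' := S.mem_component hv
  simp only [LinearMap.comp_apply, LinearEquiv.coe_coe, TensorProduct.map_tmul, LinearMap.id_apply]
  rw [φ.assocEquiv_tmul hv' hw hz, map_smul, map_smul,
    S.repBraid_tmul v (φ.tmul_mem_component hw hz),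
    φ.assocEquiv_tmul hw hz (S.mem_component (S.act_mem _ s v hv)), S.repBraid_tmul v hw,
    φ.assocEquiv_tmul hw (S.mem_component (S.act_mem x s v hv)) hz, map_smul,
    TensorProduct.map_tmul, LinearMap.id_apply, LinearEquiv.coe_coe, S.repBraid_tmul _ hz,
    S.act_act x y s v hv, TensorProduct.tmul_smul, TensorProduct.tmul_smul, smul_smul, smul_smul]
  have h := congrArg (Units.val : kˣ → k) (φ.χ_mul x y s)
  simp only [Units.val_mul] at h
  rw [h]

/-- The map `S.repBraid` as an isomorphism of modules. -/
noncomputable def repBraiding (U : QuasiBialgebra.Rep φ.quasiBialgebra) :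
    φ.rep S.ρ ⊗ U ≅ U ⊗ φ.rep S.ρ :=
  QuasiBialgebra.Rep.mkIso (X := QuasiBialgebra.Rep.tensor (φ.rep S.ρ) U)
    (Y := QuasiBialgebra.Rep.tensor U (φ.rep S.ρ)) (S.repBraid U.ρ) (S.repBraid_act U.ρ)

theorem repBraiding_tensor (U U' : QuasiBialgebra.Rep φ.quasiBialgebra) :
    (α_ (φ.rep S.ρ) U U').hom ≫ (S.repBraiding (U ⊗ U')).hom ≫ (α_ U U' (φ.rep S.ρ)).hom =
      (S.repBraiding U).hom ▷ U' ≫ (α_ U (φ.rep S.ρ) U').hom ≫ U ◁ (S.repBraiding U').hom :=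
  QuasiBialgebra.Rep.hom_ext _ _ (S.repBraid_tensor U.ρ U'.ρ)

/-- The half-braiding given by a cocycle crossed module structure. -/
noncomputable def halfBraiding : HalfBraiding (φ.rep S.ρ) where
  β := S.repBraiding
  monoidal U U' := by
    rw [← cancel_epi (α_ (φ.rep S.ρ) U U').hom, ← cancel_mono (α_ U U' (φ.rep S.ρ)).hom]
    simpa using S.repBraiding_tensor U U'
  naturality f := QuasiBialgebra.Rep.hom_ext _ _ (S.repBraid_natural _ _ f.lin f.comm)

theorem centerStructure_halfBraiding : centerStructure S.halfBraiding = S := by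
  refine eq_of_grading_le (fun s => le_of_eq (congrFun (component_action S.isInternal) s))
    fun x s v _ => ?_
  change TensorProduct.lid k V (S.repBraid (pointAct k x) (v ⊗ₜ (1 : k))) = _
  rw [S.repBraid_tmul v (mem_component_pointAct x 1), TensorProduct.lid_tmul, one_smul]

end CrossedStructure

/-! ### The isomorphism of braided monoidal categories -/

namespace ThreeCocycle

open FunctionAlgebra

variable {k : Type u} {G : Type w} [Field k] [Group G] [Fintype G] [DecidableEq G]
  {φ : ThreeCocycle k G}

section

variable {V W : Type u} [AddCommGroup V] [Module k V] [AddCommGroup W] [Module k W]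
  {ρV : (G → k) →ₐ[k] Module.End k V} {ρW : (G → k) →ₐ[k] Module.End k W}

/-- Bijectivity on objects needs equality in the centre, where the type of the half-braiding depends
on the module. Once the actions are identified, only the underlying linear maps remain to be
compared. -/
theorem sigma_eq {ρV' : (G → k) →ₐ[k] Module.End k V} {b : HalfBraiding (φ.rep ρV)}
    {b' : HalfBraiding (φ.rep ρV')} (hρ : ρV = ρV')
    (hb : ∀ U : QuasiBialgebra.Rep φ.quasiBialgebra, braidLin b U.ρ = braidLin b' U.ρ) :
    (⟨φ.rep ρV, b⟩ : φ.Double) = ⟨φ.rep ρV', b'⟩ := by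
  subst hρ
  have h : b.β = b'.β := funext fun U => Iso.ext (QuasiBialgebra.Rep.hom_ext _ _ (hb U))
  cases b
  cases b'
  cases h
  rfl

/-- The action is recovered from its eigenspaces, and the half-braiding from its values on
one-dimensional modules by `braidLin_tmul`. -/
theorem halfBraiding_centerStructure (b : HalfBraiding (φ.rep ρV)) :
    (⟨φ.rep (centerStructure b).ρ, (centerStructure b).halfBraiding⟩ : φ.Double) =
      ⟨φ.rep ρV, b⟩ := by
  refine sigma_eq (action_component ρV) fun U => ?_
  refine (isInternal_component U.ρ).tensorProduct_ext_right fun x v w hw => ?_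
  rw [braidLin_tmul b v hw]
  exact (centerStructure b).repBraid_tmul v hw

theorem map_act_of_isCrossedHom {b : HalfBraiding (φ.rep ρV)}
    {c : HalfBraiding (φ.rep ρW)}
    {f : V →ₗ[k] W} (hf : IsCrossedHom (centerStructure b) (centerStructure c) f) (h : G → k)
    (v : V) : f (ρV h v) = ρW h (f v) := by
  refine LinearMap.congr_fun (f := f ∘ₗ ρV h) (g := ρW h ∘ₗ f) ?_ v
  refine (isInternal_component ρV).linearMap_ext fun s v hv => ?_
  rw [LinearMap.comp_apply, LinearMap.comp_apply, hv h, map_smul]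
  exact (hf.map_mem s v hv h).symm

/-- Both half-braidings are given on homogeneous `w` by the actions, which `f` intertwines. Together
with `map_act_of_isCrossedHom` this gives fullness. -/
theorem braidLin_comp_map_of_isCrossedHom {b : HalfBraiding (φ.rep ρV)}
    {c : HalfBraiding (φ.rep ρW)}
    {f : V →ₗ[k] W} (hf : IsCrossedHom (centerStructure b) (centerStructure c) f) {U : Type u}
    [AddCommGroup U] [Module k U] (ρU : (G → k) →ₐ[k] Module.End k U) :
    braidLin c ρU ∘ₗ TensorProduct.map f LinearMap.id =
      TensorProduct.map LinearMap.id f ∘ₗ braidLin b ρU := by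
  refine (isInternal_component ρU).tensorProduct_ext_right fun x v w hw => ?_
  simp only [LinearMap.comp_apply, TensorProduct.map_tmul, LinearMap.id_apply]
  rw [braidLin_tmul b v hw, braidLin_tmul c _ hw, TensorProduct.map_tmul]
  exact congrArg (w ⊗ₜ[k] ·) (hf.map_act x v).symm

theorem assocEquiv_eq {Z : Type u} [AddCommGroup Z] [Module k Z]
    {ρZ : (G → k) →ₐ[k] Module.End k Z} (b : HalfBraiding (φ.rep ρV))
    (c : HalfBraiding (φ.rep ρW)) (d : HalfBraiding (φ.rep ρZ)) :
    (φ.quasiBialgebra.assocEquiv ρV ρW ρZ).toLinearMap =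
      ((centerStructure b).assoc (centerStructure c) (centerStructure d)).toLinearMap := by
  refine (isInternal_component ρV).tensor₃_ext (isInternal_component ρW) (isInternal_component ρZ)
    fun s t r v hv w hw z hz => ?_
  rw [LinearEquiv.coe_coe, LinearEquiv.coe_coe, φ.assocEquiv_tmul hv hw hz]
  exact (CrossedStructure.assoc_tmul (centerStructure b) (centerStructure c) (centerStructure d)
    hv hw hz).symm

theorem comp_map_id {Z : Type u} [AddCommGroup Z] [Module k Z] (f : V ⊗[k] W →ₗ[k] Z) :
    (f ∘ₗ LinearMap.id) ∘ₗ TensorProduct.map LinearMap.id LinearMap.id = f := by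
  rw [TensorProduct.map_id]
  rfl

/-- The associativity axiom of the functor, in the shape it takes when all structure maps are
identities; `comp_map_id` plays the same role for the unit axioms. -/
theorem assocEquiv_comp {Z : Type u} [AddCommGroup Z] [Module k Z]
    {ρZ : (G → k) →ₐ[k] Module.End k Z} (b : HalfBraiding (φ.rep ρV))
    (c : HalfBraiding (φ.rep ρW)) (d : HalfBraiding (φ.rep ρZ)) :
    ((φ.quasiBialgebra.assocEquiv ρV ρW ρZ).toLinearMap ∘ₗ LinearMap.id) ∘ₗ
        TensorProduct.map LinearMap.id LinearMap.id =
      (LinearMap.id ∘ₗ TensorProduct.map LinearMap.id LinearMap.id) ∘ₗ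
        ((centerStructure b).assoc (centerStructure c) (centerStructure d)).toLinearMap := by
  rw [TensorProduct.map_id, TensorProduct.map_id, assocEquiv_eq b c d]
  rfl

theorem braidLin_eq (b : HalfBraiding (φ.rep ρV)) (c : HalfBraiding (φ.rep ρW)) :
    braidLin b ρW = ((centerStructure b).braid (centerStructure c)).toLinearMap := by
  refine (isInternal_component ρW).tensorProduct_ext_right fun x v w hw => ?_
  rw [braidLin_tmul b v hw]
  exact ((centerStructure b).braid_tmul (centerStructure c) v hw).symm

end

variable (φ) in
/-- The functor from the double category to cocycle crossed modules. -/
noncomputable abbrev doubleFunctor : φ.Double ⥤ Crossed φ :=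
  functorOfStructure (fun X => centerStructure (φ := φ) (ρV := X.1.ρ) X.2)
    fun _ _ f => double_isCrossedHom f

theorem doubleFunctor_bijective : Function.Bijective φ.doubleFunctor.obj := by
  refine Function.bijective_iff_has_inverse.2
    ⟨fun C => ⟨φ.rep C.str.ρ, C.str.halfBraiding⟩, fun X => ?_, fun C => ?_⟩
  · exact halfBraiding_centerStructure (φ := φ) (ρV := X.1.ρ) X.2
  · exact congrArg (Crossed.mk C.V) C.str.centerStructure_halfBraiding

instance : φ.doubleFunctor.Faithful where
  map_injective h := Center.ext _ _ (QuasiBialgebra.Rep.hom_ext _ _ (congrArg Crossed.Hom.lin h))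

instance : φ.doubleFunctor.Full where
  map_surjective {X Y} f :=
    ⟨⟨⟨f.lin, map_act_of_isCrossedHom (ρV := X.1.ρ) (ρW := Y.1.ρ) (b := X.2) (c := Y.2)
        f.isCrossedHom⟩, fun U => QuasiBialgebra.Rep.hom_ext _ _
          (braidLin_comp_map_of_isCrossedHom (ρV := X.1.ρ) (ρW := Y.1.ρ) (b := X.2) (c := Y.2)
            f.isCrossedHom U.ρ)⟩, rfl⟩

instance : φ.doubleFunctor.EssSurj where
  mem_essImage C := by
    obtain ⟨X, rfl⟩ := doubleFunctor_bijective.2 C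
    exact ⟨X, ⟨Iso.refl _⟩⟩

instance : φ.doubleFunctor.IsEquivalence where

/-- Equal structures on the same space give isomorphic objects. -/
def isoOfEq {V : Type u} [AddCommGroup V] [Module k V] {S T : CrossedStructure φ V} (h : S = T) :
    (⟨V, S⟩ : Crossed φ) ≅ ⟨V, T⟩ :=
  -- The underlying map is literally the identity, so the coherence conditions reduce to equalities
  -- of linear maps.
  Crossed.mkIso (X := ⟨V, S⟩) (Y := ⟨V, T⟩) (LinearEquiv.refl k V)
    (by subst h; exact ⟨fun _ _ h => h, fun _ _ => rfl⟩)

variable (φ) in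
/-- The monoidal structure of the functor, given by identity maps. -/
noncomputable def doubleFunctorCore : φ.doubleFunctor.CoreMonoidal where
  εIso := isoOfEq double_unit_structure.symm
  μIso X Y := isoOfEq (double_tensor_structure X Y).symm
  μIso_hom_natural_left _ _ := Crossed.hom_ext _ _ rfl
  μIso_hom_natural_right _ _ := Crossed.hom_ext _ _ rfl
  associativity X Y Z := Crossed.hom_ext _ _
    (assocEquiv_comp (ρV := X.1.ρ) (ρW := Y.1.ρ) (ρZ := Z.1.ρ) X.2 Y.2 Z.2)
  left_unitality X := Crossed.hom_ext _ _
    (comp_map_id (TensorProduct.lid k X.1.V).toLinearMap).symm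
  right_unitality X := Crossed.hom_ext _ _
    (comp_map_id (TensorProduct.rid k X.1.V).toLinearMap).symm

noncomputable instance : φ.doubleFunctor.Monoidal := (doubleFunctorCore φ).toMonoidal

noncomputable instance : φ.doubleFunctor.Braided where
  braided X Y := Crossed.hom_ext _ _
    (braidLin_eq (ρV := X.1.ρ) (ρW := Y.1.ρ) X.2 Y.2)

end ThreeCocycle

theorem proposition4p1 {k : Type u} [Field k] {G : Type w} [Group G] [Fintype G] [DecidableEq G]
    (φ : ThreeCocycle k G) :
    -- `χ` is a normalised 2-cocycle with values in the functions on `G`, on which `G` acts by `Ad`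
    ((∀ x y z s : G,
        φ.χ y z (x⁻¹ * s * x) * φ.χ x (y * z) s = φ.χ x y s * φ.χ (x * y) z s) ∧
      (∀ x s : G, φ.χ 1 x s = 1 ∧ φ.χ x 1 s = 1)) ∧
    -- the tensor product of cocycle crossed modules
    (∀ (V W : Crossed φ) (s t : G), ∀ v ∈ V.str.grading s, ∀ w ∈ W.str.grading t,
      v ⊗ₜ[k] w ∈ (V ⊗ W).str.grading (s * t) ∧
      ∀ x : G, (V ⊗ W).str.act x (v ⊗ₜ[k] w) =
        ((φ x (x⁻¹ * s * x) (x⁻¹ * t * x) * φ s t x / φ s x (x⁻¹ * t * x) : kˣ) : k) •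
          (V.str.act x v ⊗ₜ[k] W.str.act x w)) ∧
    -- the category of cocycle crossed modules is braided
    ∃ _ : BraidedCategory (Crossed φ),
      (∀ (V W : Crossed φ) (t : G) (v : V.V), ∀ w ∈ W.str.grading t,
        (β_ V W).hom.lin (v ⊗ₜ[k] w) = w ⊗ₜ[k] V.str.act t v) ∧
      -- it is the double category of modules over `k^φ(G)`
      ∃ (S : ∀ X : φ.Double, CrossedStructure φ X.1.V)
        (hS : ∀ (X Y : φ.Double) (f : X ⟶ Y),
          IsCrossedHom (S X) (S Y) f.f.lin),
        -- functions on `G` act on elements of degree `s` by their value at `s`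
        (∀ (X : φ.Double) (s : G) (v : X.1.V),
          v ∈ (S X).grading s ↔ ∀ f : G → k, X.1.ρ f v = f s • v) ∧
        -- `λ (v ⊗ w) = w ⊗ (v ◁ |w|)`
        (∀ (X : φ.Double) (W : QuasiBialgebra.Rep φ.quasiBialgebra) (x : G) (v : X.1.V) (w : W.V),
          (∀ f : G → k, W.ρ f w = f x • w) →
            (X.2.β W).hom.lin (v ⊗ₜ[k] w) = w ⊗ₜ[k] (S X).act x v) ∧
        -- an isomorphism of categories
        (functorOfStructure S hS).IsEquivalence ∧
        Function.Bijective (functorOfStructure S hS).obj ∧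
        -- the tensor products agree
        (∀ X Y : φ.Double, S (X ⊗ Y) = (S X).tensor (S Y)) ∧
        -- as a functor of braided monoidal categories
        ∃ _ : (functorOfStructure S hS).Braided,
          (∀ (X Y : φ.Double) (v : X.1.V ⊗[k] Y.1.V),
            ((Functor.LaxMonoidal.μ (functorOfStructure S hS) X Y).lin v : X.1.V ⊗[k] Y.1.V) = v) ∧
          (∀ c : k, (Functor.LaxMonoidal.ε (functorOfStructure S hS)).lin c = c) := by
  -- The grading of `centerStructure` consists of the eigenspaces by definition, and the structure
  -- maps of the functor are identities on vectors, so the corresponding clauses hold by unfolding.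
  refine ⟨⟨φ.χ_cocycle, fun x s => ⟨φ.χ_one_left x s, φ.χ_one_right x s⟩⟩,
    fun V W s t v hv w hw => ⟨CrossedStructure.tmul_mem V.str W.str hv hw,
      fun x => CrossedStructure.tensor_act_tmul V.str W.str x hv hw⟩,
    inferInstance, fun V W t v w hw => V.str.braid_tmul W.str v hw,
    fun X => ThreeCocycle.centerStructure (φ := φ) (ρV := X.1.ρ) X.2,
    fun _ _ f => ThreeCocycle.double_isCrossedHom f, fun _ _ _ => Iff.rfl,
    fun X W x v w hw => ThreeCocycle.braidLin_tmul (φ := φ) (ρV := X.1.ρ) X.2 v hw,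
    inferInstanceAs φ.doubleFunctor.IsEquivalence, ThreeCocycle.doubleFunctor_bijective,
    ThreeCocycle.double_tensor_structure, inferInstanceAs φ.doubleFunctor.Braided,
    fun _ _ _ => rfl, fun _ => rfl⟩
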